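/- Let $\Lambda$ be an artin algebra, i.e. an algebra over a commutative artinian ring $k$ that is finitely generated as a $k$-module. For a ring $R$, $\mathrm{mod}\,R$ denotes the finitely generated left $R$-modules, $\mathrm{gld}\,R$ the global dimension, and $\tau_M N$ the trace of $M$ in $N$, i.e. the submodule of $N$ generated by the images of all homomorphisms $M\to N$. *The function $\phi_r$.* For an artin algebra $R$ let $K(R)$ be the abelian group generated by symbols $[M]$, $M\in\mathrm{mod}\,R$, modulo $[C]=[A]+[B]$ whenever $C\simeq A\oplus B$, and $[I]=0$ whenever $I$ is injective. Let $\Omega^{-1}:K(R)\to K(R)$ be the homomorphism $[M]\mapsto[\Omega^{-1}M]$ induced by the cosyzygy, and let $\langle\mathrm{add}\,M\rangle\subseteq K(R)$ be the subgroup generated by the classes of the indecomposable direct summands of $M$. Then $\phi_r(M)=\phi_r^R(M)$ is the least integer $n\ge 0$ such that $\Omega^{-1}:\Omega^{-s}\langle\mathrm{add}\,M\rangle\to\Omega^{-(s+1)}\langle\mathrm{add}\,M\rangle$ is an isomorphism for all $s\ge n$. For a class $\mathcal X$ of modules in $\mathrm{mod}\,R$, $\phi_r\dim\mathcal X=\sup\{\phi_r(X):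 X\in\mathcal X\}$, and $\phi_r\dim R=\phi_r\dim(\mathrm{mod}\,R)$. Let $\mathfrak A$ be a strong idempotent ideal of $\Lambda$: a two-sided ideal with $\mathfrak A^2=\mathfrak A$ such that the canonical map $\mathrm{Ext}^i_{\Lambda/\mathfrak A}(X,Y)\to\mathrm{Ext}^i_\Lambda(X,Y)$ is an isomorphism for all $i\ge 0$ and all $X,Y\in\mathrm{mod}\,\Lambda/\mathfrak A$. Assume that $\mathrm{gld}(\Lambda/\mathfrak A)$ is finite, and let $\mathrm{pd}\,(\Lambda/\mathfrak A)_\Lambda$ (possibly infinite) be the projective dimension of $\Lambda/\mathfrak A$ as a right $\Lambda$-module (for $\mathfrak A=\Lambda$ the projective dimension of the zero module and the global dimension of the zero ring are $-\infty$). Then: (a) For every $T\in\mathrm{mod}\,\Lambda$, $$\phi_r(T)\le\max\{\mathrm{gld}(\Lambda/\mathfrak A)+\mathrm{pd}\,(\Lambda/\mathfrak A)_\Lambda+1,\ \phi_r(T/\tau_{\Lambda/\mathfrak A}T)\},$$ where both values of $\phi_r$ are taken over $\Lambda$. (b) Let $\mathbb T$ be the class of all $T\in\mathrm{mod}\,\Lambda$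 with $\mathrm{Ext}^i_\Lambda(\Lambda/\mathfrak A,T)=0$ for all $i\ge 1$. Let $P$ be any finitely generated projective left $\Lambda$-module with $\tau_P\Lambda=\mathfrak A$, and let $\Gamma=\mathrm{End}_\Lambda(P)^{op}$. Then $$\phi_r\dim\mathbb T\le\max\{\mathrm{gld}(\Lambda/\mathfrak A)+\mathrm{pd}\,(\Lambda/\mathfrak A)_\Lambda+1,\ \phi_r\dim\Gamma\},$$ where $\phi_r\dim\mathbb T$ is computed over $\Lambda$. -/

import Mathlib

open CategoryTheory

universe u v

/-! Left modules over a ring `R`; `mod R` is the category `FGModuleCat.{u} R` of finitely generated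
left `R`-modules. -/

/-- The trace `τ_M N` of `M` in `N`: the submodule of `N` generated by the images of all
homomorphisms from `M` to `N`. -/
def moduleTrace (R : Type u) [Ring R] (M N : Type u) [AddCommGroup M] [Module R M]
    [AddCommGroup N] [Module R N] : Submodule R N :=
  ⨆ f : M →ₗ[R] N, LinearMap.range f

/-- The (left) global dimension of `R`: the supremum of the projective dimensions of the finitely
generated left `R`-modules. -/
noncomputable def globalDim (R : Type u) [Ring R] : WithBot ℕ∞ :=
  ⨆ M : FGModuleCat.{u} R, projectiveDimension M.obj

section RestrictScalars

variable {R S : Type u} [Ring R] [Ring S] (f : R →+* S)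

lemma restrictScalars_map_exact' (E : ShortComplex (ModuleCat.{u} S)) (h : E.Exact) :
    (E.map (ModuleCat.restrictScalars.{u} f)).Exact := by
  rw [ShortComplex.ShortExact.moduleCat_exact_iff_function_exact] at h ⊢
  exact h

instance restrictScalars_preservesFiniteLimits :
    Limits.PreservesFiniteLimits (ModuleCat.restrictScalars.{u} f) := by
  have := ((Functor.exact_tfae (ModuleCat.restrictScalars.{u} f)).out 1 3).mp
    (restrictScalars_map_exact' f)
  exact this.1

instance restrictScalars_preservesFiniteColimits :
    Limits.PreservesFiniteColimits (ModuleCat.restrictScalars.{u} f) := by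
  have := ((Functor.exact_tfae (ModuleCat.restrictScalars.{u} f)).out 1 3).mp
    (restrictScalars_map_exact' f)
  exact this.2

end RestrictScalars

section Ideals

variable {R : Type u} [Ring R] (A : Ideal R) [A.IsTwoSided]

/-- The quotient ring `R ⧸ A` as a right `R`-module, that is, as a left module over `Rᵐᵒᵖ`. -/
noncomputable def rightQuotient : ModuleCat.{u} Rᵐᵒᵖ :=
  (ModuleCat.restrictScalars (RingHom.op (Ideal.Quotient.mk A))).obj
    (ModuleCat.of (R ⧸ A)ᵐᵒᵖ (R ⧸ A))

/-- A two-sided idempotent ideal `A` of `R` is strong idempotent if for all finitely generated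
`R ⧸ A`-modules `X`, `Y` and all `i ≥ 0` the homomorphism `Ext^i_{R ⧸ A}(X, Y) → Ext^i_R(X, Y)`
induced by the (exact) restriction of scalars is bijective. -/
def IsStrongIdempotent : Prop :=
  IsIdempotentElem A ∧ ∀ (X Y : FGModuleCat.{u} (R ⧸ A)) (i : ℕ), Function.Bijective
    ((ModuleCat.restrictScalars.{u} (Ideal.Quotient.mk A)).mapExtAddHom X.obj Y.obj i)

/-- The class `𝕋` of the finitely generated `R`-modules `T` with `Ext^i_R(R ⧸ A, T) = 0` for all
`i ≥ 1`. -/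
def classT : Set (FGModuleCat.{u} R) :=
  {T | ∀ i : ℕ, 1 ≤ i → Subsingleton (Abelian.Ext.{u} (ModuleCat.of R (R ⧸ A)) T.obj i)}

end Ideals

/-! ### The dual Igusa-Todorov function -/

section Phi

variable (R : Type u) [Ring R]

/-- The relations `[C] = [A] + [B]` if `C ≃ A ⊕ B`, and `[I] = 0` if `I` is injective. -/
def kRelations : Set (FreeAbelianGroup (FGModuleCat.{u} R)) :=
  {x | ∃ A B C : FGModuleCat.{u} R, Nonempty (C ≃ₗ[R] A × B) ∧
      x = FreeAbelianGroup.of C - (FreeAbelianGroup.of A + FreeAbelianGroup.of B)} ∪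
  {x | ∃ I : FGModuleCat.{u} R, Module.Injective R I ∧ x = FreeAbelianGroup.of I}

/-- The abelian group generated by the symbols `[M]`, for `M` a finitely generated `R`-module,
modulo the relations `[C] = [A] + [B]` if `C ≃ A ⊕ B`, and `[I] = 0` if `I` is injective. -/
abbrev KInj : Type (u + 1) :=
  FreeAbelianGroup (FGModuleCat.{u} R) ⧸ AddSubgroup.closure (kRelations R)

variable {R}

/-- The class `[M]` of a finitely generated module. -/
def kClass (M : FGModuleCat.{u} R) : KInj R :=
  QuotientAddGroup.mk (FreeAbelianGroup.of M)

lemma kClass_add {A B C : FGModuleCat.{u} R} (e : C ≃ₗ[R] A × B) :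
    kClass C = kClass A + kClass B := by
  have h : FreeAbelianGroup.of C - (FreeAbelianGroup.of A + FreeAbelianGroup.of B) ∈
      AddSubgroup.closure (kRelations R) :=
    AddSubgroup.subset_closure (Or.inl ⟨A, B, C, ⟨e⟩, rfl⟩)
  have h' := (QuotientAddGroup.eq_zero_iff _).mpr h
  exact sub_eq_zero.mp h'

lemma kClass_injective (I : FGModuleCat.{u} R) (hI : Module.Injective R I) : kClass I = 0 :=
  (QuotientAddGroup.eq_zero_iff _).mpr (AddSubgroup.subset_closure (Or.inr ⟨I, hI, rfl⟩))

/-- There is a short exact sequence `0 → M → I → C → 0` in `mod R` with `I` injective. Taking for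
`M → I` an injective envelope, `C` is the cosyzygy `Ω⁻¹ M`; by `kClass_eq_of_isCosyzygy` below the
class of `C` in `KInj R` is the same for every choice of the sequence. -/
def IsCosyzygy (M C : FGModuleCat.{u} R) : Prop :=
  ∃ (I : FGModuleCat.{u} R) (f : M →ₗ[R] I) (g : I →ₗ[R] C), Module.Injective R I ∧
    Function.Injective f ∧ Function.Exact f g ∧ Function.Surjective g

/-- Every module in `mod R` embeds in an injective module in `mod R` (as is the case over every
artin algebra). -/
def EnoughInjectivesFG (R : Type u) [Ring R] : Prop :=
  ∀ M : FGModuleCat.{u} R, ∃ C : FGModuleCat.{u} R, IsCosyzygy M C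

lemma kClass_eq_of_isCosyzygy {M C D : FGModuleCat.{u} R} (hC : IsCosyzygy M C)
    (hD : IsCosyzygy M D) : kClass C = kClass D := by
  obtain ⟨I, f, g, hI, hf, hfg, hg⟩ := hC
  obtain ⟨J, f', g', hJ, hf', hfg', hg'⟩ := hD
  obtain ⟨a, ha⟩ := hJ.out f hf f'
  obtain ⟨b, hb⟩ := hI.out f' hf' f
  let p : (I × J) →ₗ[R] (C × J) := g.prodMap LinearMap.id
  let q : (I × J) →ₗ[R] (I × D) := LinearMap.id.prodMap g'
  let θ : (I × J) ≃ₗ[R] (I × J) :=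
    { toFun := fun x => (x.1 - b (x.2 + a x.1), x.2 + a x.1)
      invFun := fun y => (y.1 + b y.2, y.2 - a (y.1 + b y.2))
      map_add' := fun x y => by ext <;> simp <;> abel
      map_smul' := fun r x => by ext <;> simp [smul_sub]
      left_inv := fun x => by ext <;> simp
      right_inv := fun y => by ext <;> simp }
  have hθ : LinearMap.ker p = LinearMap.ker (q.comp θ.toLinearMap) := by
    ext ⟨i, j⟩
    have h1 : p (i, j) = (g i, j) := rfl
    have h2 : q.comp θ.toLinearMap (i, j) = (i - b (j + a i), g' (j + a i)) := rfl
    rw [LinearMap.mem_ker, LinearMap.mem_ker, h1, h2, Prod.mk_eq_zero, Prod.mk_eq_zero]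
    constructor
    · rintro ⟨h, rfl⟩
      obtain ⟨m, rfl⟩ := (hfg i).mp h
      simp [ha, hb, hfg'.apply_apply_eq_zero]
    · rintro ⟨h, h'⟩
      obtain ⟨m, hm⟩ := (hfg' _).mp h'
      have hi : i = f m := by rw [← hb m, hm]; exact sub_eq_zero.mp h
      subst hi
      rw [ha m] at hm
      exact ⟨hfg.apply_apply_eq_zero m, by simpa using hm⟩
  have hp : Function.Surjective p := Function.Surjective.prodMap hg Function.surjective_id
  have hq : Function.Surjective (q.comp θ.toLinearMap) := by
    have hq' : Function.Surjective q := Function.Surjective.prodMap Function.surjective_id hg'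
    exact hq'.comp θ.surjective
  let e : (C × J) ≃ₗ[R] (I × D) :=
    (p.quotKerEquivOfSurjective hp).symm ≪≫ₗ Submodule.quotEquivOfEq _ _ hθ ≪≫ₗ
      (q.comp θ.toLinearMap).quotKerEquivOfSurjective hq
  have h1 : kClass (FGModuleCat.of R (C × J)) = kClass C + kClass J :=
    kClass_add (LinearEquiv.refl R (C × J))
  have h2 : kClass (FGModuleCat.of R (C × J)) = kClass I + kClass D := kClass_add e
  rw [kClass_injective J hJ, add_zero] at h1
  rw [kClass_injective I hI, zero_add] at h2
  rw [← h1, h2]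

lemma IsCosyzygy.prod {A B C A' B' : FGModuleCat.{u} R} (hA : IsCosyzygy A A')
    (hB : IsCosyzygy B B') (e : C ≃ₗ[R] A × B) : IsCosyzygy C (FGModuleCat.of R (A' × B')) := by
  obtain ⟨I, f, g, hI, hf, hfg, hg⟩ := hA
  obtain ⟨J, f', g', hJ, hf', hfg', hg'⟩ := hB
  refine ⟨FGModuleCat.of R (I × J), (f.prodMap f').comp e.toLinearMap, g.prodMap g', ?_,
    (Function.Injective.prodMap hf hf').comp e.injective, ?_, Function.Surjective.prodMap hg hg'⟩
  · refine ⟨fun X Y _ _ _ _ i hi h => ?_⟩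
    obtain ⟨s, hs⟩ := hI.out i hi ((LinearMap.fst R I J).comp h)
    obtain ⟨t, ht⟩ := hJ.out i hi ((LinearMap.snd R I J).comp h)
    exact ⟨s.prod t, fun x => Prod.ext (hs x) (ht x)⟩
  · rintro ⟨i, j⟩
    constructor
    · intro h
      obtain ⟨m, hm⟩ := (hfg i).mp (congrArg Prod.fst h)
      obtain ⟨n, hn⟩ := (hfg' j).mp (congrArg Prod.snd h)
      exact ⟨e.symm (m, n), by
        change (f.prodMap f') (e (e.symm (m, n))) = _
        rw [e.apply_symm_apply]; exact Prod.ext hm hn⟩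
    · rintro ⟨c, hc⟩
      have h1 : f (e c).1 = i := congrArg Prod.fst hc
      have h2 : f' (e c).2 = j := congrArg Prod.snd hc
      exact Prod.ext ((hfg i).mpr ⟨_, h1⟩) ((hfg' j).mpr ⟨_, h2⟩)

lemma isCosyzygy_injective (I : FGModuleCat.{u} R) (hI : Module.Injective R I) :
    IsCosyzygy I (FGModuleCat.of R PUnit.{u + 1}) :=
  ⟨I, LinearMap.id, 0, hI, Function.injective_id,
    fun x => ⟨fun _ => ⟨x, rfl⟩, fun _ => rfl⟩, fun _ => ⟨0, rfl⟩⟩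

lemma kClass_punit : kClass (FGModuleCat.of R PUnit.{u + 1}) = 0 :=
  kClass_injective _ ⟨fun _ _ _ _ _ _ _ _ _ => ⟨0, fun _ => rfl⟩⟩

lemma cosyzygy_wellDefined (h : EnoughInjectivesFG R) : AddSubgroup.closure (kRelations R) ≤
    (FreeAbelianGroup.lift fun M => kClass (h M).choose).ker := by
  rw [AddSubgroup.closure_le]
  rintro x (⟨A, B, C, ⟨e⟩, rfl⟩ | ⟨I, hI, rfl⟩)
  · have h1 := kClass_eq_of_isCosyzygy (h C).choose_spec
      ((h A).choose_spec.prod (h B).choose_spec e)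
    have h2 : kClass (FGModuleCat.of R ((h A).choose × (h B).choose)) =
        kClass (h A).choose + kClass (h B).choose :=
      kClass_add (LinearEquiv.refl R ((h A).choose × (h B).choose))
    simp [AddMonoidHom.mem_ker, h1, h2]
  · have h1 := kClass_eq_of_isCosyzygy (h I).choose_spec (isCosyzygy_injective I hI)
    simp [AddMonoidHom.mem_ker, h1, kClass_punit]

variable (R) in
open Classical in
/-- The endomorphism `[M] ↦ [Ω⁻¹ M]` of `KInj R` induced by the cosyzygy. The value `0` is a
fallback for rings with too few injectives in `mod R`; it does not occur for artin algebras. -/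
noncomputable def cosyzygyHom : KInj R →+ KInj R :=
  if h : EnoughInjectivesFG R then
    QuotientAddGroup.lift _ (FreeAbelianGroup.lift fun M => kClass (h M).choose)
      (cosyzygy_wellDefined h)
  else 0

lemma cosyzygyHom_kClass (h : EnoughInjectivesFG R) {M C : FGModuleCat.{u} R}
    (hC : IsCosyzygy M C) : cosyzygyHom R (kClass M) = kClass C := by
  rw [cosyzygyHom, dif_pos h, kClass_eq_of_isCosyzygy hC (h M).choose_spec]
  exact (QuotientAddGroup.lift_mk' _ _ _).trans (FreeAbelianGroup.lift_apply_of _ _)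

/-- The subgroup `Ω⁻ˢ⟨add M⟩` of `KInj R`, where `⟨add M⟩` is generated by the classes of the
indecomposable direct summands of `M`. -/
noncomputable def cosyzygyAdd (M : FGModuleCat.{u} R) : ℕ → AddSubgroup (KInj R)
  | 0 => AddSubgroup.closure {x | ∃ X Y : FGModuleCat.{u} R, Indecomposable X.obj ∧
      Nonempty (M ≃ₗ[R] X × Y) ∧ x = kClass X}
  | s + 1 => (cosyzygyAdd M s).map (cosyzygyHom R)

/-- The dual Igusa-Todorov function: `φ_r(M)` is the least `n` such that the cosyzygy induces an
isomorphism `Ω⁻ˢ⟨add M⟩ → Ω⁻⁽ˢ⁺¹⁾⟨add M⟩` for every `s ≥ n`. -/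
noncomputable def phiR (M : FGModuleCat.{u} R) : ℕ∞ :=
  ⨅ n ∈ {n : ℕ | ∀ s : ℕ, n ≤ s → Set.BijOn (cosyzygyHom R) (cosyzygyAdd M s)
    (cosyzygyAdd M (s + 1))}, (n : ℕ∞)

/-- The `φ_r`-dimension of a class of finitely generated modules. -/
noncomputable def phiRDim (S : Set (FGModuleCat.{u} R)) : ℕ∞ :=
  ⨆ M ∈ S, phiR M

end Phi

/-! Write R for the algebra, B = R ⧸ A, and τX for the trace of B in X, which is the largest
submodule of X killed by A (`mem_moduleTrace_quotient_iff`). Only the case where gld B + pd B_R is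
bounded by a natural number s needs work.

Part (a). Every module killed by A has injective dimension at most s over R. An injective B-module
is a retract of a dual Hom_ℤ(B, Q) with Q divisible, and dualizing a projective resolution of the
right module B bounds the injective dimension of that dual by pd B_R. An injective coresolution over
B, of length at most gld B, then gives the general case (`hasInjectiveDimensionLT_of_smul_eq_zero`).
Apply the horseshoe lemma to 0 → τX → X → X/τX → 0: after s cosyzygies the left term is injective,
the sequence splits, and X and X/τX have the same class (`iterate_cosyzygyHom_kClass_eq`). Since X ↦
X/τX is additive, Ω⁻ˢ⟨add T⟩ ⊆ Ω⁻ˢ⟨add T/τT⟩, whence φ_r(T) ≤ max(s, φ_r(T/τT)). The summand 1 in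
the stated bound is slack.

Part (b). For T in 𝕋 the module Y = T/τT satisfies Ext^i(B, Y) = 0 for all i ≥ 0: degree 0 because A
is idempotent, higher degrees because Ext^{i+1}(B, τT) can be computed over B, where B is projective
(`isExtOrthogonal_quotient_moduleTrace`). On such modules F = Hom_R(P, -) loses nothing: with G =
Hom_Γ(Hom_R(P, R), -), the unit M → GFM is bijective (`DualHom.unit_bijective`). An injective hull
of an orthogonal module is torsion-free, F keeps it injective, and the cosyzygy is again orthogonal;
so F commutes with cosyzygies there. Thus F and G induce maps ρ and γ of the groups `KInj` with γρ
the identity on orthogonal classes, and injectivity of Ω⁻¹ over Γ pulls back to R: φ_r(Y) ≤ φ_r(FY)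
(`phiR_le_of_hom`).

F need not preserve injectivity outside the orthogonal class, so ρ is defined by first projecting a
module to its orthogonal part. Uniqueness of that part is a Krull-Schmidt argument
(`IsAddClosed.exists_hom`). -/

/-! ### Fitting's lemma, cancellation and exchange -/

section KrullSchmidt

/-- A module is indecomposable if it is nonzero and has no proper nonzero direct summand. -/
def IsIndecomposableModule (R M : Type*) [Ring R] [AddCommGroup M] [Module R M] : Prop :=
  Nontrivial M ∧ ∀ p q : Submodule R M, IsCompl p q → p = ⊥ ∨ q = ⊥

variable {R : Type*} [Ring R] {M N C J : Type*} [AddCommGroup M] [Module R M] [AddCommGroup N]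
  [Module R N] [AddCommGroup C] [Module R C] [AddCommGroup J] [Module R J]

/-- Fitting's lemma: one of two endomorphisms with sum `1` of an indecomposable module of finite
length is bijective. -/
lemma IsIndecomposableModule.bijective_or_bijective [IsNoetherian R M] [IsArtinian R M]
    (h : IsIndecomposableModule R M) {f g : M →ₗ[R] M} (hfg : f + g = LinearMap.id) :
    Function.Bijective f ∨ Function.Bijective g := by
  obtain ⟨n, hn⟩ := Filter.eventually_atTop.mp
    (LinearMap.eventually_isCompl_ker_pow_range_pow (R := R) (M := M) f)
  -- The exponent must be positive for ker f to be contained in the kernel of the power.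
  have hn' := hn (n + 1) (Nat.le_succ n)
  rcases h.2 _ _ hn' with hk | hr
  · left
    apply IsArtinian.bijective_of_injective_endomorphism
    rw [← LinearMap.ker_eq_bot, eq_bot_iff]
    intro x hx
    rw [← hk, LinearMap.mem_ker, pow_succ, Module.End.mul_apply]
    rw [LinearMap.mem_ker] at hx
    rw [hx, map_zero]
  · right
    have hnil : IsNilpotent (f : Module.End R M) := ⟨n + 1, LinearMap.range_eq_bot.mp hr⟩
    have hg : g = 1 - (f : Module.End R M) := by
      rw [eq_sub_iff_add_eq, add_comm]; exact hfg
    rw [hg]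
    exact (Module.End.isUnit_iff _).mp hnil.isUnit_one_sub

/-- If the component `C → C` of an isomorphism `M × C ≃ N × C` is bijective then `M ≃ N`. -/
lemma nonempty_linearEquiv_of_bijective_component (e : (M × C) ≃ₗ[R] N × C)
    (h : Function.Bijective fun c : C => (e (0, c)).2) : Nonempty (M ≃ₗ[R] N) := by
  let u : C ≃ₗ[R] C := LinearEquiv.ofBijective
    (LinearMap.snd R N C ∘ₗ e.toLinearMap ∘ₗ LinearMap.inr R M C) h
  have hu : ∀ c, (e (0, c)).2 = u c := fun c => rfl
  -- The graph of `s` is the preimage of N × 0 under `e`, so m ↦ (m, s m) followed by `e` identifies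
  -- M with N.
  let s : M →ₗ[R] C :=
    -(u.symm.toLinearMap ∘ₗ LinearMap.snd R N C ∘ₗ e.toLinearMap ∘ₗ LinearMap.inl R M C)
  have hs : ∀ m, u (s m) = -(e (m, 0)).2 := fun m => by simp [s]
  have hsplit : ∀ m c, (e (m, c)).2 = (e (m, 0)).2 + u c := fun m c => by
    rw [← hu, ← Prod.snd_add, ← map_add]; simp
  let f : M →ₗ[R] N := LinearMap.fst R N C ∘ₗ e.toLinearMap ∘ₗ LinearMap.prod LinearMap.id s
  have hf : ∀ m, e (m, s m) = (f m, 0) := fun m =>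
    Prod.ext rfl (by rw [hsplit, hs]; simp)
  refine ⟨LinearEquiv.ofBijective f ⟨?_, fun n => ?_⟩⟩
  · rw [← LinearMap.ker_eq_bot, eq_bot_iff]
    intro m hm
    have h0 : e (m, s m) = 0 := by rw [hf, LinearMap.mem_ker.mp hm]; rfl
    have := (e.map_eq_zero_iff).mp h0
    exact congrArg Prod.fst this
  · obtain ⟨⟨m, c⟩, hmc⟩ := e.surjective (n, 0)
    have hc : c = s m := by
      apply u.injective
      have := hsplit m c
      rw [hmc] at this
      rw [hs]
      exact (neg_eq_of_add_eq_zero_right this.symm).symm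
    refine ⟨m, ?_⟩
    have := hf m
    rw [← hc, hmc] at this
    exact (congrArg Prod.fst this).symm

/-- Indecomposable modules of finite length can be cancelled from direct sums. -/
lemma IsIndecomposableModule.cancel [IsNoetherian R C] [IsArtinian R C]
    (h : IsIndecomposableModule R C) (e : (M × C) ≃ₗ[R] N × C) : Nonempty (M ≃ₗ[R] N) := by
  let d : C →ₗ[R] C := LinearMap.snd R N C ∘ₗ e.toLinearMap ∘ₗ LinearMap.inr R M C
  let b : C →ₗ[R] N := LinearMap.fst R N C ∘ₗ e.toLinearMap ∘ₗ LinearMap.inr R M C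
  let c' : N →ₗ[R] C := LinearMap.snd R M C ∘ₗ e.symm.toLinearMap ∘ₗ LinearMap.inl R N C
  let d' : C →ₗ[R] C := LinearMap.snd R M C ∘ₗ e.symm.toLinearMap ∘ₗ LinearMap.inr R N C
  have h1 : c' ∘ₗ b + d' ∘ₗ d = LinearMap.id := by
    ext x
    have : e.symm (b x, 0) + e.symm (0, d x) = (0, x) := by
      rw [← map_add, LinearEquiv.symm_apply_eq]
      simp [b, d]
    exact congrArg Prod.snd this
  rcases h.bijective_or_bijective h1 with hb | hd
  · let w : C ≃ₗ[R] C := LinearEquiv.ofBijective _ hb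
    have hw : ∀ x, w.symm (c' (b x)) = x := fun x => w.symm_apply_apply x
    -- Chosen so that d + t ∘ b = id: shearing by `t` makes the C → C component the identity.
    let t : N →ₗ[R] C := (LinearMap.id - d) ∘ₗ w.symm.toLinearMap ∘ₗ c'
    let θ : (N × C) ≃ₗ[R] N × C :=
      { toFun := fun x => (x.1, x.2 + t x.1)
        invFun := fun x => (x.1, x.2 - t x.1)
        map_add' := fun x y => by ext <;> simp; abel
        map_smul' := fun r x => by ext <;> simp
        left_inv := fun x => by ext <;> simp
        right_inv := fun x => by ext <;> simp }
    refine nonempty_linearEquiv_of_bijective_component (e ≪≫ₗ θ) ?_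
    convert Function.bijective_id with x
    change d x + t (b x) = x
    simp [t, hw]
  · refine nonempty_linearEquiv_of_bijective_component e ?_
    exact IsArtinian.bijective_of_injective_endomorphism d
      (Function.Injective.of_comp (f := d') hd.1)

/-- If `C → N → C` is bijective then `C` is a direct summand of `N`. -/
lemma nonempty_linearEquiv_prod_ker (i : C →ₗ[R] N) (r : N →ₗ[R] C)
    (h : Function.Bijective (r ∘ₗ i)) : Nonempty (N ≃ₗ[R] C × LinearMap.ker r) := by
  let w : C ≃ₗ[R] C := LinearEquiv.ofBijective _ h
  have hw : ∀ c, r (i (w.symm c)) = c := fun c => w.apply_symm_apply c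
  let k : N →ₗ[R] LinearMap.ker r := LinearMap.codRestrict _
    (LinearMap.id - i ∘ₗ w.symm.toLinearMap ∘ₗ r) fun n => by simp [LinearMap.mem_ker, hw]
  exact ⟨
    { toFun := fun n => (r n, k n)
      map_add' := fun x y => by simp
      map_smul' := fun a x => by simp
      invFun := fun x => i (w.symm x.1) + x.2
      left_inv := fun n => by simp [k]
      right_inv := fun x => by
        have hx : r (x.2 : N) = 0 := x.2.2
        refine Prod.ext ?_ (Subtype.ext ?_)
        · simp [hw, hx]
        · simp [k, hw, hx] }⟩

/-- An indecomposable summand of `N × J` is a summand of `N` or of `J`. -/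
lemma IsIndecomposableModule.exchange [IsNoetherian R C] [IsArtinian R C]
    (h : IsIndecomposableModule R C) (e : (C × M) ≃ₗ[R] N × J) :
    (∃ p : Submodule R N, Nonempty (N ≃ₗ[R] C × p)) ∨
      ∃ p : Submodule R J, Nonempty (J ≃ₗ[R] C × p) := by
  let a : C →ₗ[R] N := LinearMap.fst R N J ∘ₗ e.toLinearMap ∘ₗ LinearMap.inl R C M
  let b : C →ₗ[R] J := LinearMap.snd R N J ∘ₗ e.toLinearMap ∘ₗ LinearMap.inl R C M
  let a' : N →ₗ[R] C := LinearMap.fst R C M ∘ₗ e.symm.toLinearMap ∘ₗ LinearMap.inl R N J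
  let b' : J →ₗ[R] C := LinearMap.fst R C M ∘ₗ e.symm.toLinearMap ∘ₗ LinearMap.inr R N J
  have h1 : a' ∘ₗ a + b' ∘ₗ b = LinearMap.id := by
    ext x
    have : e.symm (a x, 0) + e.symm (0, b x) = (x, 0) := by
      rw [← map_add, LinearEquiv.symm_apply_eq]
      simp [a, b]
    exact congrArg Prod.fst this
  rcases h.bijective_or_bijective h1 with h2 | h2
  · exact Or.inl ⟨_, nonempty_linearEquiv_prod_ker a a' h2⟩
  · exact Or.inr ⟨_, nonempty_linearEquiv_prod_ker b b' h2⟩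

end KrullSchmidt

section ProductEquivs

variable {R A B C D : Type*} [Ring R] [AddCommGroup A] [Module R A] [AddCommGroup B] [Module R B]
  [AddCommGroup C] [Module R C] [AddCommGroup D] [Module R D]

/-- `(A × B) × C ≃ B × (A × C)`. -/
def LinearEquiv.prodLeftSwap : ((A × B) × C) ≃ₗ[R] B × (A × C) :=
  ((LinearEquiv.prodComm R A B).prodCongr (LinearEquiv.refl R C)) ≪≫ₗ LinearEquiv.prodAssoc R B A C

end ProductEquivs

/-! ### Classes of modules closed under finite sums and summands -/

section AddClosed

variable {R : Type u} [Ring R]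

/-- Bridge from the submodule formulation used for Krull-Schmidt to the categorical one in
`cosyzygyAdd`: a biproduct decomposition pulls back to complementary submodules. -/
lemma IsIndecomposableModule.indecomposable {X : FGModuleCat.{u} R}
    (h : IsIndecomposableModule R X) : Indecomposable X.obj := by
  refine ⟨fun h0 => ?_, fun Y Z i => ?_⟩
  · have := ModuleCat.subsingleton_of_isZero h0
    exact not_subsingleton_iff_nontrivial.mpr h.1 this
  · let e : X ≃ₗ[R] Y × Z := (i ≪≫ ModuleCat.biprodIsoProd Y Z).toLinearEquiv
    have hc : IsCompl ((Submodule.prod ⊤ ⊥ : Submodule R (Y × Z)).comap e.toLinearMap)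
        ((Submodule.prod ⊥ ⊤ : Submodule R (Y × Z)).comap e.toLinearMap) := by
      refine IsCompl.of_eq ?_ ?_
      · rw [eq_bot_iff]
        rintro x ⟨h1, h2⟩
        have h3 : (e x).1 = 0 := h2.1
        have h4 : (e x).2 = 0 := h1.2
        exact e.map_eq_zero_iff.mp (Prod.ext h3 h4)
      · rw [eq_top_iff]
        intro x _
        have : x = e.symm ((e x).1, 0) + e.symm (0, (e x).2) := by
          rw [← map_add, eq_comm, LinearEquiv.symm_apply_eq]; simp
        rw [this]
        exact Submodule.add_mem_sup (by simp) (by simp)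
    rcases h.2 _ _ hc with h0 | h0
    · left
      refine @ModuleCat.isZero_of_subsingleton _ _ _ ⟨fun y y' => ?_⟩
      have hy : ∀ y : Y, y = 0 := fun y => by
        have hm : e.symm (y, 0) ∈ (⊥ : Submodule R X) := by rw [← h0]; simp
        have := (e.symm.map_eq_zero_iff).mp hm
        exact congrArg Prod.fst this
      rw [hy y, hy y']
    · right
      refine @ModuleCat.isZero_of_subsingleton _ _ _ ⟨fun y y' => ?_⟩
      have hy : ∀ y : Z, y = 0 := fun y => by
        have hm : e.symm (0, y) ∈ (⊥ : Submodule R X) := by rw [← h0]; simp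
        have := (e.symm.map_eq_zero_iff).mp hm
        exact congrArg Prod.snd this
      rw [hy y, hy y']

lemma Module.Injective.of_subsingleton (I : Type u) [AddCommGroup I] [Module R I]
    [Subsingleton I] : Module.Injective R I :=
  ⟨fun _ _ _ _ _ _ _ _ _ => ⟨0, fun _ => Subsingleton.elim _ _⟩⟩

lemma kClass_eq_zero_of_subsingleton (I : FGModuleCat.{u} R) [Subsingleton I] : kClass I = 0 :=
  kClass_injective I (Module.Injective.of_subsingleton I)

lemma kClass_congr {M N : FGModuleCat.{u} R} (e : M ≃ₗ[R] N) : kClass M = kClass N := by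
  have := kClass_add (A := N) (B := FGModuleCat.of R PUnit.{u + 1})
    (e ≪≫ₗ LinearEquiv.prodUnique.symm)
  rwa [kClass_punit, add_zero] at this

/-- A class of finitely generated modules closed under finite direct sums and summands. -/
structure IsAddClosed (Q : FGModuleCat.{u} R → Prop) : Prop where
  of_subsingleton (M : FGModuleCat.{u} R) [Subsingleton M] : Q M
  prod {A B C : FGModuleCat.{u} R} (e : C ≃ₗ[R] A × B) : Q A → Q B → Q C
  summand {A B C : FGModuleCat.{u} R} (e : C ≃ₗ[R] A × B) : Q C → Q A

/-- The module `C` has no nonzero direct summand in the class `Q`. -/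
def HasNoSummandIn (Q : FGModuleCat.{u} R → Prop) (C : FGModuleCat.{u} R) : Prop :=
  ∀ E W : FGModuleCat.{u} R, Nonempty (C ≃ₗ[R] E × W) → Q E → Subsingleton E

namespace IsAddClosed

variable {Q : FGModuleCat.{u} R → Prop}

lemma congr (hQ : IsAddClosed Q) {M N : FGModuleCat.{u} R} (e : M ≃ₗ[R] N) (h : Q N) : Q M :=
  hQ.prod (A := N) (B := FGModuleCat.of R PUnit.{u + 1}) (e ≪≫ₗ LinearEquiv.prodUnique.symm) h
    (hQ.of_subsingleton (FGModuleCat.of R PUnit.{u + 1}))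

end IsAddClosed

lemma Module.Injective.of_prod {I A B : Type u} [AddCommGroup I] [Module R I] [AddCommGroup A]
    [Module R A] [AddCommGroup B] [Module R B] (hI : Module.Injective R I) (e : I ≃ₗ[R] A × B) :
    Module.Injective R A := by
  refine ⟨fun X Y _ _ _ _ i hi g => ?_⟩
  obtain ⟨h, hh⟩ := hI.out i hi (e.symm.toLinearMap ∘ₗ LinearMap.inl R A B ∘ₗ g)
  exact ⟨LinearMap.fst R A B ∘ₗ e.toLinearMap ∘ₗ h, fun x => by simp [hh]⟩

end AddClosed

/-! ### Decomposition relative to a class of modules, and induced maps on `KInj` -/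

section Decomposition

variable {R : Type u} [Ring R] [IsNoetherianRing R] [IsArtinianRing R]

instance (M : FGModuleCat.{u} R) : IsNoetherian R M :=
  isNoetherian_of_isNoetherianRing_of_finite R M

instance (M : FGModuleCat.{u} R) : IsArtinian R M :=
  isArtinian_of_fg_of_artinian'

lemma FGModuleCat.length_lt_of_prod {M E W : FGModuleCat.{u} R} (e : M ≃ₗ[R] E × W)
    [Nontrivial E] : Module.length R W < Module.length R M := by
  rw [e.length_eq, Module.length_prod]
  have h1 : Module.length R W ≠ ⊤ := Module.length_ne_top
  have h2 : 0 < Module.length R E := Module.length_pos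
  calc Module.length R W = 0 + Module.length R W := (zero_add _).symm
    _ < _ := (ENat.add_lt_add_iff_right h1).mpr h2

/-- A nonzero finitely generated module has an indecomposable direct summand. -/
lemma FGModuleCat.exists_indecomposable_summand (M : FGModuleCat.{u} R) [hM : Nontrivial M] :
    ∃ E W : FGModuleCat.{u} R, IsIndecomposableModule R E ∧ Nonempty (M ≃ₗ[R] E × W) := by
  induction h : Module.length R M using WellFoundedLT.induction generalizing M with
  | ind n ih =>
  by_cases hM' : IsIndecomposableModule R M
  · exact ⟨M, FGModuleCat.of R PUnit.{u + 1}, hM', ⟨LinearEquiv.prodUnique.symm⟩⟩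
  · simp only [IsIndecomposableModule, hM, true_and, not_forall, not_or] at hM'
    obtain ⟨p, q, hpq, hp, hq⟩ := hM'
    let e : (p × q) ≃ₗ[R] M := Submodule.prodEquivOfIsCompl p q hpq
    have hq' : Nontrivial (FGModuleCat.of R q) := Submodule.nontrivial_iff_ne_bot.mpr hq
    have hp' : Nontrivial (FGModuleCat.of R p) := Submodule.nontrivial_iff_ne_bot.mpr hp
    have hlt : Module.length R (FGModuleCat.of R p) < Module.length R M :=
      FGModuleCat.length_lt_of_prod (E := FGModuleCat.of R q) (W := FGModuleCat.of R p)
        (e.symm ≪≫ₗ LinearEquiv.prodComm R p q)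
    obtain ⟨E, W, hE, ⟨f⟩⟩ := ih _ (h ▸ hlt) (FGModuleCat.of R p) rfl
    exact ⟨E, FGModuleCat.of R (W × q), hE,
      ⟨e.symm ≪≫ₗ f.prodCongr (LinearEquiv.refl R q) ≪≫ₗ LinearEquiv.prodAssoc R E W q⟩⟩

/-- The class of every direct summand of `M` lies in `⟨add M⟩`. -/
lemma kClass_mem_cosyzygyAdd_zero {M X Y : FGModuleCat.{u} R} (e : M ≃ₗ[R] X × Y) :
    kClass X ∈ cosyzygyAdd M 0 := by
  induction h : Module.length R X using WellFoundedLT.induction generalizing X Y with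
  | ind n ih =>
  rcases subsingleton_or_nontrivial X with hX | hX
  · rw [kClass_eq_zero_of_subsingleton]
    exact zero_mem _
  · obtain ⟨E, W, hE, ⟨f⟩⟩ := X.exists_indecomposable_summand
    have hE' := hE.1
    rw [kClass_add f]
    let g : M ≃ₗ[R] (E × W) × Y := e ≪≫ₗ f.prodCongr (LinearEquiv.refl R Y)
    -- With X = E × W, the indecomposable E is a summand of M, and the shorter W is a summand of M
    -- with complement E × Y.
    refine add_mem (AddSubgroup.subset_closure
      ⟨E, FGModuleCat.of R (W × Y), hE.indecomposable, ⟨g ≪≫ₗ LinearEquiv.prodAssoc R E W Y⟩, rfl⟩)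
      (ih _ (h ▸ FGModuleCat.length_lt_of_prod f) (Y := FGModuleCat.of R (E × Y))
        (g ≪≫ₗ LinearEquiv.prodLeftSwap) rfl)

namespace IsAddClosed

variable {Q : FGModuleCat.{u} R → Prop}

/-- Splitting off a nonzero summand in `Q` strictly lowers the length, so the process stops. -/
lemma exists_decomposition (hQ : IsAddClosed Q) (M : FGModuleCat.{u} R) : ∃ A C : FGModuleCat.{u} R,
    Q A ∧ HasNoSummandIn Q C ∧ Nonempty (M ≃ₗ[R] A × C) := by
  induction h : Module.length R M using WellFoundedLT.induction generalizing M with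
  | ind n ih =>
  by_cases hM : HasNoSummandIn Q M
  · exact ⟨FGModuleCat.of R PUnit.{u + 1}, M, hQ.of_subsingleton _, hM,
      ⟨LinearEquiv.uniqueProd.symm⟩⟩
  · simp only [HasNoSummandIn, not_forall] at hM
    obtain ⟨E, W, ⟨e⟩, hE, hE'⟩ := hM
    have := not_subsingleton_iff_nontrivial.mp hE'
    obtain ⟨A, C, hA, hC, ⟨f⟩⟩ := ih _ (h ▸ FGModuleCat.length_lt_of_prod e) W rfl
    exact ⟨FGModuleCat.of R (E × A), C,
      hQ.prod (LinearEquiv.refl R (E × A)) hE hA, hC,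
      ⟨e ≪≫ₗ (LinearEquiv.refl R E).prodCongr f ≪≫ₗ (LinearEquiv.prodAssoc R E A C).symm⟩⟩

/-- The `Q`-part of a finitely generated module is unique up to isomorphism. -/
lemma nonempty_linearEquiv_of_decomposition (hQ : IsAddClosed Q) {A B C D : FGModuleCat.{u} R}
    (hA : Q A) (hB : Q B)
    (hC : HasNoSummandIn Q C) (hD : HasNoSummandIn Q D) (e : (A × C) ≃ₗ[R] B × D) :
    Nonempty (A ≃ₗ[R] B) := by
  induction h : Module.length R A using WellFoundedLT.induction generalizing A B with
  | ind n ih =>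
  rcases subsingleton_or_nontrivial A with hA' | hA'
  · have : Unique A := ⟨⟨0⟩, fun _ => Subsingleton.elim _ _⟩
    have := hC B D ⟨LinearEquiv.uniqueProd.symm ≪≫ₗ e⟩ hB
    exact ⟨LinearEquiv.ofSubsingleton A B⟩
  · obtain ⟨E, A', hE, ⟨f⟩⟩ := A.exists_indecomposable_summand
    have hE' := hE.1
    let g : (E × (A' × C)) ≃ₗ[R] B × D :=
      (LinearEquiv.prodAssoc R E A' C).symm ≪≫ₗ f.symm.prodCongr (LinearEquiv.refl R C) ≪≫ₗ e
    -- The indecomposable E is a summand of B or of D. In the first case E is cancelled and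
    -- induction applies; the second is excluded because E lies in `Q`.
    rcases hE.exchange g with ⟨p, ⟨k⟩⟩ | ⟨p, ⟨k⟩⟩
    · let g' : ((A' × C) × E) ≃ₗ[R] (p × D) × E :=
        LinearEquiv.prodComm R _ _ ≪≫ₗ g ≪≫ₗ k.prodCongr (LinearEquiv.refl R D) ≪≫ₗ
          LinearEquiv.prodAssoc R E p D ≪≫ₗ LinearEquiv.prodComm R _ _
      obtain ⟨g''⟩ := hE.cancel g'
      obtain ⟨t⟩ := ih _ (h ▸ FGModuleCat.length_lt_of_prod f) (B := FGModuleCat.of R p)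
        (hQ.summand (f ≪≫ₗ LinearEquiv.prodComm R E A') hA)
        (hQ.summand (A := FGModuleCat.of R p) (k ≪≫ₗ LinearEquiv.prodComm R E p) hB) g'' rfl
      exact ⟨f ≪≫ₗ (LinearEquiv.refl R E).prodCongr t ≪≫ₗ k.symm⟩
    · have := hD E (FGModuleCat.of R p) ⟨k⟩ (hQ.summand f hA)
      exact absurd this (not_subsingleton_iff_nontrivial.mpr hE')

/-- The `Q`-part of a finitely generated module. -/
noncomputable def part (hQ : IsAddClosed Q) (M : FGModuleCat.{u} R) : FGModuleCat.{u} R :=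
  (hQ.exists_decomposition M).choose

/-- The complement of the `Q`-part of a finitely generated module. -/
noncomputable def rest (hQ : IsAddClosed Q) (M : FGModuleCat.{u} R) : FGModuleCat.{u} R :=
  (hQ.exists_decomposition M).choose_spec.choose

lemma part_mem (hQ : IsAddClosed Q) (M : FGModuleCat.{u} R) : Q (hQ.part M) :=
  (hQ.exists_decomposition M).choose_spec.choose_spec.1

lemma rest_spec (hQ : IsAddClosed Q) (M : FGModuleCat.{u} R) : HasNoSummandIn Q (hQ.rest M) :=
  (hQ.exists_decomposition M).choose_spec.choose_spec.2.1

lemma decomposition (hQ : IsAddClosed Q) (M : FGModuleCat.{u} R) :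
    Nonempty (M ≃ₗ[R] hQ.part M × hQ.rest M) :=
  (hQ.exists_decomposition M).choose_spec.choose_spec.2.2

/-- By exchange, an indecomposable summand of a nonzero `Q`-summand of C × D, itself in `Q`, would
be a summand of C or of D. -/
lemma hasNoSummandIn_prod (hQ : IsAddClosed Q) {C D : FGModuleCat.{u} R} (hC : HasNoSummandIn Q C)
    (hD : HasNoSummandIn Q D) : HasNoSummandIn Q (FGModuleCat.of R (C × D)) := by
  rintro E W ⟨e⟩ hE
  by_contra hE'
  have := not_subsingleton_iff_nontrivial.mp hE'
  obtain ⟨X, Y, hX, ⟨f⟩⟩ := E.exists_indecomposable_summand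
  have hX' := not_subsingleton_iff_nontrivial.mpr hX.1
  have hQX := hQ.summand f hE
  let g : (X × (Y × W)) ≃ₗ[R] C × D := (LinearEquiv.prodAssoc R X Y W).symm ≪≫ₗ
    f.symm.prodCongr (LinearEquiv.refl R W) ≪≫ₗ e.symm
  rcases hX.exchange g with ⟨p, ⟨k⟩⟩ | ⟨p, ⟨k⟩⟩
  · exact hX' (hC X (FGModuleCat.of R p) ⟨k⟩ hQX)
  · exact hX' (hD X (FGModuleCat.of R p) ⟨k⟩ hQX)

lemma part_prod (hQ : IsAddClosed Q) {A B C : FGModuleCat.{u} R} (e : C ≃ₗ[R] A × B) :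
    Nonempty (hQ.part C ≃ₗ[R] hQ.part A × hQ.part B) := by
  obtain ⟨a⟩ := hQ.decomposition A
  obtain ⟨b⟩ := hQ.decomposition B
  obtain ⟨c⟩ := hQ.decomposition C
  exact hQ.nonempty_linearEquiv_of_decomposition (B := FGModuleCat.of R (hQ.part A × hQ.part B))
    (D := FGModuleCat.of R (hQ.rest A × hQ.rest B)) (hQ.part_mem C)
    (hQ.prod (LinearEquiv.refl R _) (hQ.part_mem A) (hQ.part_mem B)) (hQ.rest_spec C)
    (hQ.hasNoSummandIn_prod (hQ.rest_spec A) (hQ.rest_spec B))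
    (c.symm ≪≫ₗ e ≪≫ₗ a.prodCongr b ≪≫ₗ LinearEquiv.prodProdProdComm R _ _ _ _)

lemma part_of_mem (hQ : IsAddClosed Q) {A : FGModuleCat.{u} R} (hA : Q A) :
    Nonempty (A ≃ₗ[R] hQ.part A) := by
  obtain ⟨a⟩ := hQ.decomposition A
  have := hQ.rest_spec A (hQ.rest A) (FGModuleCat.of R PUnit.{u + 1})
    ⟨LinearEquiv.prodUnique.symm⟩ (hQ.summand (a ≪≫ₗ LinearEquiv.prodComm R _ _) hA)
  have : Unique (hQ.rest A) := ⟨⟨0⟩, fun _ => Subsingleton.elim _ _⟩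
  exact ⟨a ≪≫ₗ LinearEquiv.prodUnique⟩

end IsAddClosed

/-- An additive assignment on the modules of a class `Q` closed under finite sums and summands that
preserves injectivity induces a homomorphism of the groups `KInj`. -/
lemma IsAddClosed.exists_hom {S : Type u} [Ring S] {Q : FGModuleCat.{u} R → Prop}
    (hQ : IsAddClosed Q) (F : FGModuleCat.{u} R → FGModuleCat.{u} S)
    (hF : ∀ {A B C : FGModuleCat.{u} R}, (C ≃ₗ[R] A × B) → Nonempty (F C ≃ₗ[S] F A × F B))
    (hF' : ∀ I : FGModuleCat.{u} R, Q I → Module.Injective R I → Module.Injective S (F I)) :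
    ∃ ρ : KInj R →+ KInj S, ∀ M : FGModuleCat.{u} R, Q M → ρ (kClass M) = kClass (F M) := by
  have key : ∀ {A B C : FGModuleCat.{u} R}, (C ≃ₗ[R] A × B) →
      kClass (F C) = kClass (F A) + kClass (F B) := fun e => by
    obtain ⟨f⟩ := hF e
    exact kClass_add f
  have hz : kClass (F (FGModuleCat.of R PUnit.{u + 1})) = 0 := by
    have := key (A := FGModuleCat.of R PUnit.{u + 1}) (B := FGModuleCat.of R PUnit.{u + 1})
      (C := FGModuleCat.of R PUnit.{u + 1}) LinearEquiv.prodUnique.symm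
    simpa using this
  have hcongr : ∀ {A B : FGModuleCat.{u} R}, (A ≃ₗ[R] B) → kClass (F A) = kClass (F B) :=
    fun {A B} e => by
      have := key (A := B) (B := FGModuleCat.of R PUnit.{u + 1}) (C := A)
        (e ≪≫ₗ LinearEquiv.prodUnique.symm)
      rwa [hz, add_zero] at this
  -- The map sends [M] to the class of F applied to the `Q`-part of M. Taking the part is additive,
  -- and the part of an injective module is an injective module in `Q`, where F is known to preserve
  -- injectivity.
  have hle : AddSubgroup.closure (kRelations R) ≤
      (FreeAbelianGroup.lift fun M => kClass (F (hQ.part M))).ker := by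
    rw [AddSubgroup.closure_le]
    rintro x (⟨A, B, C, ⟨e⟩, rfl⟩ | ⟨I, hI, rfl⟩)
    · obtain ⟨f⟩ := hQ.part_prod e
      simp [AddMonoidHom.mem_ker, key f]
    · obtain ⟨f⟩ := hQ.decomposition I
      have := kClass_injective _ (hF' _ (hQ.part_mem I) (hI.of_prod f))
      simp [AddMonoidHom.mem_ker, this]
  refine ⟨QuotientAddGroup.lift _ _ hle, fun M hM => ?_⟩
  obtain ⟨f⟩ := hQ.part_of_mem hM
  exact ((QuotientAddGroup.lift_mk' _ _ _).trans (FreeAbelianGroup.lift_apply_of _ _)).trans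
    (hcongr f).symm

end Decomposition

/-! ### Injective hulls -/

section InjectiveHull

variable {R : Type u} [Ring R]

/-- The submodule `S` of `E` is essential. -/
def Submodule.IsEssential {E : Type*} [AddCommGroup E] [Module R E] (S : Submodule R E) : Prop :=
  ∀ q : Submodule R E, q ⊓ S = ⊥ → q = ⊥

/-- A submodule that is maximal among those meeting `E` trivially. -/
lemma Submodule.exists_maximal_disjoint {Q : Type*} [AddCommGroup Q] [Module R Q]
    (E : Submodule R Q) :
    ∃ C : Submodule R Q, C ⊓ E = ⊥ ∧ ∀ D, C ≤ D → D ⊓ E = ⊥ → D = C := by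
  obtain ⟨C, hC⟩ := zorn_le₀ {C : Submodule R Q | C ⊓ E = ⊥} fun c hc hchain => by
    rcases c.eq_empty_or_nonempty with rfl | hne
    · exact ⟨⊥, bot_inf_eq _, by simp⟩
    · refine ⟨sSup c, ?_, fun z hz => le_sSup hz⟩
      rw [Set.mem_ofPred_eq, eq_bot_iff]
      rintro x ⟨hx, hxE⟩
      obtain ⟨p, hp, hxp⟩ := (Submodule.mem_sSup_of_directed hne hchain.directedOn).mp hx
      have : p ⊓ E = ⊥ := hc hp
      rw [← this]
      exact ⟨hxp, hxE⟩
  exact ⟨C, hC.prop, fun D hD hDE => (hC.eq_of_ge hDE hD)⟩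

/-- A maximal essential extension of a submodule. -/
lemma Submodule.exists_maximal_essential {Q : Type*} [AddCommGroup Q] [Module R Q]
    (S : Submodule R Q) :
    ∃ E : Submodule R Q, S ≤ E ∧ (∀ q ≤ E, q ⊓ S = ⊥ → q = ⊥) ∧
      ∀ D, E ≤ D → (∀ q ≤ D, q ⊓ S = ⊥ → q = ⊥) → D = E := by
  obtain ⟨E, hSE, hE⟩ := zorn_le_nonempty₀
    {E : Submodule R Q | S ≤ E ∧ ∀ q ≤ E, q ⊓ S = ⊥ → q = ⊥} (fun c hc hchain y hy => by
      refine ⟨sSup c, ⟨(hc hy).1.trans (le_sSup hy), fun q hq hqS => ?_⟩, fun z hz => le_sSup hz⟩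
      rw [eq_bot_iff]
      intro x hx
      obtain ⟨p, hp, hxp⟩ := (Submodule.mem_sSup_of_directed ⟨y, hy⟩ hchain.directedOn).mp (hq hx)
      have h1 : Submodule.span R {x} = ⊥ := by
        refine (hc hp).2 _ (by simpa using hxp) ?_
        rw [eq_bot_iff, ← hqS]
        exact inf_le_inf_right _ (by simpa using hx)
      simpa using h1) S ⟨le_rfl, fun q hq h => by rwa [inf_eq_left.mpr hq] at h⟩
  exact ⟨E, hE.prop.1, hE.prop.2, fun D hD hDS => hE.eq_of_ge ⟨hE.prop.1.trans hD, hDS⟩ hD⟩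

lemma Module.Injective.of_leftInverse {I A : Type u} [AddCommGroup I] [Module R I]
    [AddCommGroup A] [Module R A] (hI : Module.Injective R I) (i : A →ₗ[R] I) (r : I →ₗ[R] A)
    (h : ∀ a, r (i a) = a) : Module.Injective R A := by
  refine ⟨fun X Y _ _ _ _ j hj g => ?_⟩
  obtain ⟨k, hk⟩ := hI.out j hj (i ∘ₗ g)
  exact ⟨r ∘ₗ k, fun x => by simp [hk, h]⟩

/-- Maximal essential extensions inside an injective module are injective. -/
lemma Submodule.injective_of_maximal_essential {Q : Type u} [AddCommGroup Q] [Module R Q]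
    (hQ : Module.Injective R Q) {S E : Submodule R Q} (hSE : S ≤ E)
    (hE : ∀ q ≤ E, q ⊓ S = ⊥ → q = ⊥)
    (hmax : ∀ D, E ≤ D → (∀ q ≤ D, q ⊓ S = ⊥ → q = ⊥) → D = E) : Module.Injective R E := by
  obtain ⟨C, hC, hCmax⟩ := Submodule.exists_maximal_disjoint E
  let i : E →ₗ[R] Q ⧸ C := C.mkQ ∘ₗ E.subtype
  have hi : Function.Injective i := by
    rw [← LinearMap.ker_eq_bot, eq_bot_iff]
    intro x hx
    have h1 : (x : Q) ∈ C := by simpa [i] using hx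
    have h2 : (x : Q) ∈ (⊥ : Submodule R Q) := hC ▸ ⟨h1, x.2⟩
    exact Subtype.ext h2
  -- E embeds in Q ⧸ C, and its inclusion in Q extends over Q ⧸ C. The resulting endomorphism `t` of
  -- Q fixes E and kills C; it is the desired retraction once its range is E.
  obtain ⟨j, hj⟩ := hQ.out i hi E.subtype
  have hjm : ∀ x ∈ E, j (C.mkQ x) = x := fun x hx => hj ⟨x, hx⟩
  let t : Q →ₗ[R] Q := j ∘ₗ C.mkQ
  have hCt : C ≤ LinearMap.ker t := fun x hx => by
    simp [t, (Submodule.Quotient.mk_eq_zero C).mpr hx]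
  have hEr : E ≤ LinearMap.range t := fun x hx => ⟨x, hjm x hx⟩
  have hr : LinearMap.range t = E := by
    refine hmax _ hEr fun q hq hqS => ?_
    have hqE : q ⊓ E = ⊥ := hE _ inf_le_right (by
      rw [inf_assoc, inf_eq_right.mpr hSE, hqS])
    -- The preimage of q contains C and still meets E trivially, so maximality of C forces equality,
    -- and `t` kills C.
    have hD : q.comap t = C := by
      refine hCmax _ (fun x hx => ?_) ?_
      · have : t x = 0 := hCt hx
        simp [Submodule.mem_comap, this]
      · rw [eq_bot_iff, ← hqE]
        rintro x ⟨hx, hxE⟩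
        have : t x ∈ q := hx
        rw [show t x = x from hjm x hxE] at this
        exact ⟨this, hxE⟩
    rw [eq_bot_iff]
    intro y hy
    obtain ⟨x, rfl⟩ := hq hy
    have : x ∈ C := hD ▸ hy
    exact hCt this
  exact hQ.of_leftInverse E.subtype (t.codRestrict E fun x => hr ▸ LinearMap.mem_range_self t x)
    fun a => Subtype.ext (hjm a a.2)

/-- Every module has an injective hull. -/
lemma exists_injectiveHull (M : Type u) [AddCommGroup M] [Module R M] :
    ∃ (Q : Type u) (_ : AddCommGroup Q) (_ : Module R Q) (E : Submodule R Q) (f : M →ₗ[R] E),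
      Function.Injective f ∧ Module.Injective R E ∧ (LinearMap.range f).IsEssential := by
  obtain ⟨⟨Q, hQ, f, hf⟩⟩ := EnoughInjectives.presentation (ModuleCat.of R M)
  have hQ' : Module.Injective R Q := Module.injective_module_of_injective_object R Q
  have hf' : Function.Injective f.hom := (ModuleCat.mono_iff_injective f).mp hf
  obtain ⟨E, hSE, hE, hmax⟩ := Submodule.exists_maximal_essential (LinearMap.range f.hom)
  refine ⟨Q, inferInstance, inferInstance, E,
    f.hom.codRestrict E fun x => hSE (LinearMap.mem_range_self _ x), fun x y h => ?_,
    Submodule.injective_of_maximal_essential hQ' hSE hE hmax, fun q hq => ?_⟩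
  · exact hf' (congrArg Subtype.val h)
  · have h1 := hE (q.map E.subtype) (Submodule.map_subtype_le _ _) (by
      rw [eq_bot_iff]
      rintro _ ⟨⟨x, hx, rfl⟩, ⟨m, hm⟩⟩
      have : x ∈ (⊥ : Submodule R E) := by
        rw [← hq]
        exact ⟨hx, m, Subtype.ext hm⟩
      rw [(Submodule.mem_bot R).mp this]
      simp)
    rw [eq_bot_iff]
    intro x hx
    have : (x : Q) ∈ q.map E.subtype := ⟨x, hx, rfl⟩
    rw [h1] at this
    exact Subtype.ext this

end InjectiveHull

/-! ### Finitely generated injective hulls over artin algebras -/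

section ArtinAlgebra

variable (k : Type v) {R : Type u} [CommRing k] [Ring R] [Algebra k R]

/-- Over a finite algebra over a noetherian ring, homomorphisms from a finitely generated module to
a noetherian one form a noetherian module. -/
lemma isNoetherian_linearMap_of_finite (N E : Type*) [AddCommGroup N] [Module R N]
    [Module.Finite R N] [AddCommGroup E] [Module R E] [Module k E] [IsScalarTower k R E]
    [SMulCommClass R k E] [IsNoetherian k E] : IsNoetherian k (N →ₗ[R] E) := by
  obtain ⟨n, s, hs⟩ := Module.Finite.exists_fin (R := R) (M := N)
  let ev : (N →ₗ[R] E) →ₗ[k] (Fin n → E) :=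
    { toFun := fun f i => f (s i)
      map_add' := fun f g => rfl
      map_smul' := fun a f => rfl }
  refine isNoetherian_of_injective ev fun f g hfg => ?_
  exact LinearMap.ext_on_range hs fun i => congrFun hfg i

/-- The image of a simple module is zero or meets the essential submodule S, hence lies in S. So all
homomorphisms land in S. -/
lemma isNoetherian_linearMap_of_isSimpleModule (U E : Type*) [AddCommGroup U] [Module R U]
    [IsSimpleModule R U] [AddCommGroup E] [Module R E] [Module k E] [IsScalarTower k R E]
    [SMulCommClass R k E] (S : Submodule R E) (hS : S.IsEssential) [IsNoetherian k S] :
    IsNoetherian k (U →ₗ[R] E) := by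
  have hmem : ∀ (f : U →ₗ[R] E) (x : U), f x ∈ S := by
    intro f x
    have key : (S.comap f : Submodule R U) = ⊤ ∨ f = 0 := by
      rcases eq_bot_or_eq_top (S.comap f) with h | h
      · right
        rw [← LinearMap.range_eq_bot]
        apply hS
        rw [eq_bot_iff]
        rintro _ ⟨⟨y, rfl⟩, hy⟩
        have : y ∈ S.comap f := hy
        rw [h, Submodule.mem_bot] at this
        simp [this]
      · exact Or.inl h
    rcases key with h | rfl
    · have : x ∈ S.comap f := h ▸ Submodule.mem_top
      exact this
    · simp
  have := isNoetherian_linearMap_of_finite k (R := R) U S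
  let c : (U →ₗ[R] E) →ₗ[k] (U →ₗ[R] S) :=
    { toFun := fun f => f.codRestrict S (hmem f)
      map_add' := fun f g => rfl
      map_smul' := fun a f => rfl }
  refine isNoetherian_of_injective c fun f g hfg => LinearMap.ext fun x => ?_
  exact congrArg Subtype.val (LinearMap.congr_fun hfg x)

/-- Induction on length through the exact sequence 0 → Hom(M/N', E) → Hom(M, E) → Hom(N', E), whose
first term has simple source. -/
lemma IsFiniteLength.isNoetherian_linearMap {N : Type*} [AddCommGroup N] [Module R N]
    (hN : IsFiniteLength R N) (E : Type*) [AddCommGroup E]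
    [Module R E] [Module k E] [IsScalarTower k R E] [SMulCommClass R k E] (S : Submodule R E)
    (hS : S.IsEssential) [IsNoetherian k S] : IsNoetherian k (N →ₗ[R] E) := by
  induction hN with
  | of_subsingleton =>
    infer_instance
  | @of_simple_quotient M _ _ N' _ _ ih =>
    have := isNoetherian_linearMap_of_isSimpleModule k (M ⧸ N') E S hS
    let a : ((M ⧸ N') →ₗ[R] E) →ₗ[k] (M →ₗ[R] E) :=
      { toFun := fun f => f ∘ₗ N'.mkQ
        map_add' := fun f g => rfl
        map_smul' := fun a f => rfl }
    let b : (M →ₗ[R] E) →ₗ[k] (N' →ₗ[R] E) :=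
      { toFun := fun f => f ∘ₗ N'.subtype
        map_add' := fun f g => rfl
        map_smul' := fun a f => rfl }
    refine isNoetherian_of_range_eq_ker a b ?_
    ext f
    constructor
    · rintro ⟨g, rfl⟩
      rw [LinearMap.mem_ker]
      ext x
      change g (N'.mkQ x) = 0
      rw [Submodule.mkQ_apply, (Submodule.Quotient.mk_eq_zero N').mpr x.2, map_zero]
    · intro hf
      refine ⟨N'.liftQ f fun x hx => ?_, ?_⟩
      · exact LinearMap.congr_fun (LinearMap.mem_ker.mp hf) ⟨x, hx⟩
      · exact LinearMap.ext fun x => rfl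

lemma isArtinianRing_of_artinAlgebra [IsArtinianRing k] [Module.Finite k R] : IsArtinianRing R :=
  IsArtinianRing.of_finite k R

lemma isNoetherianRing_of_artinAlgebra [IsArtinianRing k] [Module.Finite k R] :
    IsNoetherianRing R := IsNoetherianRing.of_finite k R

/-- Essential extensions of finitely generated modules over an artin algebra are finitely
generated. -/
lemma Submodule.IsEssential.finite_of_artinAlgebra [IsArtinianRing k] [Module.Finite k R]
    {E : Type*} [AddCommGroup E] [Module R E]
    {S : Submodule R E} (hS : S.IsEssential) [Module.Finite R S] : Module.Finite R E := by
  let _ : Module k E := Module.compHom E (algebraMap k R)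
  have : IsScalarTower k R E := ⟨fun a r x => by
    rw [Algebra.smul_def, mul_smul]; rfl⟩
  have : SMulCommClass R k E := IsScalarTower.to_smulCommClass'
  have := isArtinianRing_of_artinAlgebra k (R := R)
  have := isNoetherianRing_of_artinAlgebra k (R := R)
  have : IsScalarTower k R S := ⟨fun a r x => Subtype.ext (smul_assoc a r (x : E))⟩
  have : Module.Finite k S := Module.Finite.trans R S
  have : IsFiniteLength R R :=
    (isFiniteLength_iff_isNoetherian_isArtinian).mpr ⟨inferInstance, inferInstance⟩
  -- Nothing is known about the size of E yet, but E is the image of Hom_R(R, E) and R has finite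
  -- length.
  have := this.isNoetherian_linearMap k E S hS
  let ev : (R →ₗ[R] E) →ₗ[k] E :=
    { toFun := fun f => f 1
      map_add' := fun f g => rfl
      map_smul' := fun a f => rfl }
  have : IsNoetherian k E := isNoetherian_of_surjective ev (LinearMap.range_eq_top.mpr fun x =>
    ⟨LinearMap.toSpanSingleton R E x, by simp [ev]⟩)
  exact Module.Finite.of_restrictScalars_finite k R E

/-- Finitely generated modules over an artin algebra have finitely generated injective hulls. -/
lemma exists_fg_injectiveHull [IsArtinianRing k] [Module.Finite k R]
    (M : FGModuleCat.{u} R) :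
    ∃ (I : FGModuleCat.{u} R) (f : M →ₗ[R] I), Function.Injective f ∧ Module.Injective R I ∧
      (LinearMap.range f).IsEssential := by
  obtain ⟨Q, _, _, E, f, hf, hE, hess⟩ := exists_injectiveHull (R := R) M
  have : Module.Finite R E := hess.finite_of_artinAlgebra k
  exact ⟨FGModuleCat.of R E, f, hf, hE, hess⟩

/-- This rules out the fallback value of `cosyzygyHom`. -/
lemma enoughInjectivesFG_of_artinAlgebra [IsArtinianRing k] [Module.Finite k R] :
    EnoughInjectivesFG R := fun M => by
  have := isNoetherianRing_of_artinAlgebra k (R := R)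
  obtain ⟨I, f, hf, hI, -⟩ := exists_fg_injectiveHull k M
  exact ⟨FGModuleCat.of R (I ⧸ LinearMap.range f), I, f, (LinearMap.range f).mkQ, hI, hf,
    LinearMap.exact_map_mkQ_range f, Submodule.mkQ_surjective _⟩

end ArtinAlgebra

/-! ### Ext vanishing, extension of homomorphisms and injective dimension -/

section Ext

variable {R : Type u} [Ring R]

lemma Function.Exact.shortExact {A B C : Type u} [AddCommGroup A] [Module R A] [AddCommGroup B]
    [Module R B] [AddCommGroup C] [Module R C] {f : A →ₗ[R] B} {g : B →ₗ[R] C}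
    (hfg : Function.Exact f g) (hf : Function.Injective f) (hg : Function.Surjective g) :
    (ModuleCat.shortComplexOfCompEqZero f g hfg.linearMap_comp_eq_zero).ShortExact :=
  ModuleCat.shortComplex_shortExact _ hfg hf hg

/-- The obstruction to extending g from I to R is its image under the connecting map Hom(I, M) →
Ext¹(R/I, M). The lemma serves both for Baer's criterion and for surjectivity of the unit. -/
lemma exists_extension_of_subsingleton_ext {M : Type u} [AddCommGroup M] [Module R M]
    (I : Ideal R) (h : Subsingleton
      (Abelian.Ext.{u} (ModuleCat.of R (R ⧸ I)) (ModuleCat.of R M) 1)) (g : I →ₗ[R] M) :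
    ∃ g' : R →ₗ[R] M, ∀ (x : R) (hx : x ∈ I), g' x = g ⟨x, hx⟩ := by
  have hS := Function.Exact.shortExact (LinearMap.exact_subtype_mkQ I) I.injective_subtype
    I.mkQ_surjective
  obtain ⟨φ, hφ⟩ := Abelian.Ext.contravariant_sequence_exact₁ hS _
    (Abelian.Ext.mk₀ (ModuleCat.ofHom g)) (zero_add 1) (h.elim _ _)
  obtain ⟨φ, rfl⟩ := Abelian.Ext.homEquiv₀.symm.surjective φ
  have h1 : ModuleCat.ofHom I.subtype ≫ φ = ModuleCat.ofHom g :=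
    Abelian.Ext.homEquiv₀.symm.injective (by simpa using hφ)
  exact ⟨φ.hom, fun x hx => LinearMap.congr_fun (congrArg ModuleCat.Hom.hom h1) ⟨x, hx⟩⟩

/-- A short exact sequence `0 → X → J → C → 0` with `J` injective. -/
lemma exists_injective_shortExact (X : Type u) [AddCommGroup X] [Module R X] :
    ∃ (J : Type u) (_ : AddCommGroup J) (_ : Module R J) (f : X →ₗ[R] J),
      Module.Injective R J ∧ Function.Injective f := by
  obtain ⟨Q, _, _, E, f, hf, hE, -⟩ := exists_injectiveHull (R := R) X
  exact ⟨E, inferInstance, inferInstance, f, hE, hf⟩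

/-- Injective dimension can be tested on cyclic modules. -/
lemma hasInjectiveDimensionLT_of_subsingleton_ext_quotient (n : ℕ) (X : Type u) [AddCommGroup X]
    [Module R X] (h : ∀ I : Ideal R,
      Subsingleton (Abelian.Ext.{u} (ModuleCat.of R (R ⧸ I)) (ModuleCat.of R X) (n + 1))) :
    HasInjectiveDimensionLT (ModuleCat.of R X) (n + 1) := by
  induction n generalizing X with
  | zero =>
    rw [zero_add, ← injective_iff_hasInjectiveDimensionLT_one,
      ← Module.injective_iff_injective_object]
    exact Module.Baer.injective fun I g => exists_extension_of_subsingleton_ext I (h I) g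
  | succ n ih =>
    obtain ⟨J, _, _, f, hJ, hf⟩ := exists_injective_shortExact (R := R) X
    have hS := Function.Exact.shortExact (LinearMap.exact_map_mkQ_range f) hf
      (Submodule.mkQ_surjective _)
    have hJ' : Injective (ModuleCat.of R J) := (Module.injective_iff_injective_object R J).mp hJ
    refine (hS.hasInjectiveDimensionLT_X₃_iff n hJ').mp (ih _ fun I => ⟨fun a b => ?_⟩)
    have hz : ∀ a : Abelian.Ext.{u} (ModuleCat.of R (R ⧸ I))
        (ModuleCat.of R (J ⧸ LinearMap.range f)) (n + 1), a = 0 := fun a => by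
      obtain ⟨y, rfl⟩ := Abelian.Ext.covariant_sequence_exact₃ _ hS a rfl ((h I).elim _ _)
      have : y = 0 := Abelian.Ext.eq_zero_of_injective _
      rw [this, Abelian.Ext.zero_comp]
    rw [hz a, hz b]

end Ext

/-! ### Duality between right projective and left injective dimension -/

section AdditiveDual

/-- The group of additive maps `N → Q`; a left `R`-module if `N` is a right `R`-module. -/
def AdditiveDual (N Q : Type u) [AddCommGroup N] [AddCommGroup Q] : Type u := N →+ Q

namespace AdditiveDual

variable {R : Type u} [Ring R] (N P Q : Type u) [AddCommGroup N] [AddCommGroup Q]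
  [Module Rᵐᵒᵖ N] [AddCommGroup P] [Module Rᵐᵒᵖ P]

instance : AddCommGroup (AdditiveDual N Q) := inferInstanceAs (AddCommGroup (N →+ Q))

instance : FunLike (AdditiveDual N Q) N Q := inferInstanceAs (FunLike (N →+ Q) N Q)

instance : AddMonoidHomClass (AdditiveDual N Q) N Q :=
  inferInstanceAs (AddMonoidHomClass (N →+ Q) N Q)

instance : Module R (AdditiveDual N Q) where
  smul r f := AddMonoidHom.comp f (DistribSMul.toAddMonoidHom N (MulOpposite.op r))
  one_smul f := AddMonoidHom.ext fun x => congrArg f (one_smul Rᵐᵒᵖ x)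
  mul_smul r s f := AddMonoidHom.ext fun x =>
    congrArg f (mul_smul (MulOpposite.op s) (MulOpposite.op r) x)
  smul_zero _ := rfl
  smul_add _ _ _ := rfl
  add_smul r s f := AddMonoidHom.ext fun x =>
    (congrArg f (add_smul (MulOpposite.op r) (MulOpposite.op s) x)).trans (map_add f _ _)
  zero_smul f := AddMonoidHom.ext fun x =>
    (congrArg f (zero_smul Rᵐᵒᵖ x)).trans (map_zero f)

variable {N P Q}

lemma ext {f g : AdditiveDual N Q} (h : ∀ x, f x = g x) : f = g := AddMonoidHom.ext h

lemma smul_apply (r : R) (f : AdditiveDual N Q) (x : N) :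
    (r • f) x = f (MulOpposite.op r • x) := rfl

lemma add_apply (f g : AdditiveDual N Q) (x : N) : (f + g) x = f x + g x := rfl

variable (Q) in
/-- The map of dual modules induced by a linear map. -/
def map (g : N →ₗ[Rᵐᵒᵖ] P) : AdditiveDual P Q →ₗ[R] AdditiveDual N Q where
  toFun f := AddMonoidHom.comp f g.toAddMonoidHom
  map_add' _ _ := rfl
  map_smul' r f := ext fun x => congrArg f (g.map_smul (MulOpposite.op r) x).symm

lemma map_apply (g : N →ₗ[Rᵐᵒᵖ] P) (f : AdditiveDual P Q) (x : N) : map Q g f x = f (g x) := rfl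

lemma map_injective {g : N →ₗ[Rᵐᵒᵖ] P} (hg : Function.Surjective g) :
    Function.Injective (map Q g) := fun f h hfh => ext fun x => by
  obtain ⟨y, rfl⟩ := hg x
  rw [← map_apply, hfh, map_apply]

lemma map_surjective (hQ : Module.Baer ℤ Q) {g : N →ₗ[Rᵐᵒᵖ] P} (hg : Function.Injective g) :
    Function.Surjective (map Q g) := fun f => by
  obtain ⟨h, hh⟩ := hQ.extension_property_addMonoidHom g.toAddMonoidHom hg (f : N →+ Q)
  exact ⟨h, ext fun x => DFunLike.congr_fun hh x⟩

lemma map_exact {K : Type u} [AddCommGroup K] [Module Rᵐᵒᵖ K] {f : K →ₗ[Rᵐᵒᵖ] P}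
    {g : P →ₗ[Rᵐᵒᵖ] N} (hfg : Function.Exact f g) (hg : Function.Surjective g) :
    Function.Exact (map Q g) (map Q f) := by
  intro h
  constructor
  · intro hh
    let w : (P ⧸ LinearMap.ker g) ≃+ N := (g.quotKerEquivOfSurjective hg).toAddEquiv
    let l : (P ⧸ (LinearMap.ker g).toAddSubgroup) →+ Q :=
      QuotientAddGroup.lift (LinearMap.ker g).toAddSubgroup h (fun x hx => by
        obtain ⟨y, rfl⟩ := (hfg x).mp hx
        exact DFunLike.congr_fun hh y)
    refine ⟨AddMonoidHom.comp l w.symm.toAddMonoidHom, ext fun x => ?_⟩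
    have : w.symm (g x) = (LinearMap.ker g).mkQ x := by
      rw [AddEquiv.symm_apply_eq]; rfl
    change l (w.symm (g x)) = h x
    rw [this]
    rfl
  · rintro ⟨l, rfl⟩
    refine ext fun x => ?_
    change l (g (f x)) = 0
    rw [hfg.apply_apply_eq_zero, map_zero]

/-- Duals of projective modules are injective. -/
lemma injective_of_projective (hQ : Module.Baer ℤ Q) [hP : Module.Projective Rᵐᵒᵖ P] :
    Module.Injective R (AdditiveDual P Q) := by
  obtain ⟨s, hs⟩ := hP.out
  refine ⟨fun X Y _ _ _ _ i hi g => ?_⟩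
  have hext : ∀ p : P, ∃ h : Y →+ Q, ∀ x, h (i x) = g x p := fun p => by
    obtain ⟨h, hh⟩ := hQ.extension_property_addMonoidHom i.toAddMonoidHom hi
      { toFun := fun x => g x p
        map_zero' := by rw [map_zero]; rfl
        map_add' := fun x y => by rw [map_add]; rfl }
    exact ⟨h, DFunLike.congr_fun hh⟩
  choose h hh using hext
  -- The extensions `h p` are chosen separately for each p, with no compatibility in p. Using them
  -- as coordinates on the free module over P and pulling back along the section `s` makes the
  -- result additive and linear.
  let t : Y → (P →₀ Rᵐᵒᵖ) →+ Q := fun y => Finsupp.liftAddHom fun p =>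
    { toFun := fun a => h p (a.unop • y)
      map_zero' := by simp
      map_add' := fun a b => by simp [add_smul] }
  have ht : ∀ y c, t y c = c.sum fun p a => h p (a.unop • y) := fun y c => rfl
  refine ⟨
    { toFun := fun y => (AddMonoidHom.comp (t y) s.toAddMonoidHom : P →+ Q)
      map_add' := fun y z => ext fun q => ?_
      map_smul' := fun r y => ext fun q => ?_ }, fun x => ext fun q => ?_⟩
  · change t (y + z) (s q) = t y (s q) + t z (s q)
    simp only [ht, smul_add, map_add, Finsupp.sum_add]
  · change t (r • y) (s q) = t y (s (MulOpposite.op r • q))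
    rw [map_smul, ht, ht, Finsupp.sum_smul_index (by simp)]
    simp [mul_smul]
  · change t (i x) (s q) = g x q
    rw [ht]
    conv_rhs => rw [← hs q, Finsupp.linearCombination_apply, Finsupp.sum, map_sum]
    refine Finset.sum_congr rfl fun p _ => ?_
    change h p ((s q p).unop • i x) = g x (s q p • p)
    rw [← map_smul, hh, map_smul]
    rfl

/-- The injective dimension of the dual is at most the projective dimension. -/
lemma hasInjectiveDimensionLT (hQ : Module.Baer ℤ Q) (n : ℕ) (N : Type u) [AddCommGroup N]
    [Module Rᵐᵒᵖ N] (h : HasProjectiveDimensionLT (ModuleCat.of Rᵐᵒᵖ N) (n + 1)) :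
    HasInjectiveDimensionLT (ModuleCat.of R (AdditiveDual N Q)) (n + 1) := by
  induction n generalizing N with
  | zero =>
    rw [zero_add, ← injective_iff_hasInjectiveDimensionLT_one,
      ← Module.injective_iff_injective_object]
    rw [zero_add, ← projective_iff_hasProjectiveDimensionLT_one,
      ← IsProjective.iff_projective] at h
    exact injective_of_projective hQ
  | succ n ih =>
    let g := Finsupp.linearCombination Rᵐᵒᵖ (id : N → N)
    have hg : Function.Surjective g := Finsupp.linearCombination_id_surjective Rᵐᵒᵖ N
    have hex : Function.Exact (LinearMap.ker g).subtype g := LinearMap.exact_subtype_ker_map g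
    have hS := hex.shortExact (Submodule.injective_subtype _) hg
    have hP : Projective (ModuleCat.of Rᵐᵒᵖ (N →₀ Rᵐᵒᵖ)) :=
      (IsProjective.iff_projective _).mp inferInstance
    have hK := (hS.hasProjectiveDimensionLT_X₃_iff n hP).mp h
    have hD := (map_exact (Q := Q) hex hg).shortExact (map_injective hg)
      (map_surjective hQ (Submodule.injective_subtype _))
    refine (hD.hasInjectiveDimensionLT_X₃_iff n ?_).mp (ih _ hK)
    exact (Module.injective_iff_injective_object R _).mp (injective_of_projective hQ)

end AdditiveDual

lemma exists_embedding_baer_int (J : Type u) [AddCommGroup J] :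
    ∃ (Q : Type u) (_ : AddCommGroup Q) (f : J →+ Q), Module.Baer ℤ Q ∧ Function.Injective f := by
  obtain ⟨⟨Q, hQ, f, hf⟩⟩ := EnoughInjectives.presentation (ModuleCat.of ℤ J)
  have hQ' : Module.Injective ℤ Q := Module.injective_module_of_injective_object ℤ Q
  have hB : @Module.Baer ℤ _ Q _ (AddCommGroup.toIntModule Q) := by
    -- The ℤ-module structure from `ModuleCat ℤ` and the one from the additive group agree because
    -- such structures are unique.
    convert Module.Baer.of_injective hQ'
    exact Subsingleton.elim _ _
  exact ⟨Q, inferInstance, f.hom.toAddMonoidHom, hB, (ModuleCat.mono_iff_injective f).mp hf⟩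

end AdditiveDual

/-! ### Injective dimension over `R` of modules annihilated by the ideal -/

section Quotient

variable {R : Type u} [Ring R] (A : Ideal R) [A.IsTwoSided]

/-- The injective dimension over `R` of an injective `R ⧸ A`-module. -/
lemma hasInjectiveDimensionLT_restrictScalars_of_injective (m : ℕ)
    (h : HasProjectiveDimensionLT (rightQuotient A) (m + 1)) (J : Type u) [AddCommGroup J]
    [Module (R ⧸ A) J] (hJ : Module.Injective (R ⧸ A) J) :
    HasInjectiveDimensionLT ((ModuleCat.restrictScalars.{u} (Ideal.Quotient.mk A)).obj
      (ModuleCat.of (R ⧸ A) J)) (m + 1) := by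
  obtain ⟨Q, _, f, hQ, hf⟩ := exists_embedding_baer_int J
  -- The map x ↦ (b ↦ f(bx)) embeds J in a dual of R ⧸ A; it splits because J is injective.
  let i : J →ₗ[R ⧸ A] AdditiveDual (R ⧸ A) Q :=
    { toFun := fun x =>
        { toFun := fun b => f (b • x)
          map_zero' := by simp
          map_add' := fun b c => by simp [add_smul] }
      map_add' := fun x y => AdditiveDual.ext fun b =>
        (congrArg f (smul_add b x y)).trans (map_add f _ _)
      map_smul' := fun r x => AdditiveDual.ext fun b => congrArg f (mul_smul b r x).symm }
  have hi : Function.Injective i := fun x y hxy => hf (by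
    have : f ((1 : R ⧸ A) • x) = f ((1 : R ⧸ A) • y) := DFunLike.congr_fun hxy (1 : R ⧸ A)
    simpa using this)
  obtain ⟨r, hr⟩ := hJ.out i hi LinearMap.id
  have h1 : HasInjectiveDimensionLT
      (ModuleCat.of R (AdditiveDual (rightQuotient A) Q)) (m + 1) :=
    AdditiveDual.hasInjectiveDimensionLT hQ m (rightQuotient A) h
  have h2 : HasInjectiveDimensionLT ((ModuleCat.restrictScalars.{u} (Ideal.Quotient.mk A)).obj
      (ModuleCat.of (R ⧸ A) (AdditiveDual (R ⧸ A) Q))) (m + 1) := h1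
  have ret : Retract (ModuleCat.of (R ⧸ A) J)
      (ModuleCat.of (R ⧸ A) (AdditiveDual (R ⧸ A) Q)) :=
    { i := ModuleCat.ofHom i
      r := ModuleCat.ofHom r
      retract := by
        ext x
        exact hr x }
  exact (ret.map (ModuleCat.restrictScalars.{u} (Ideal.Quotient.mk A))).hasInjectiveDimensionLT
    (m + 1)

/-- The injective dimension over `R` of an `R ⧸ A`-module. -/
lemma hasInjectiveDimensionLT_restrictScalars (m : ℕ)
    (h : HasProjectiveDimensionLT (rightQuotient A) (m + 1)) (n : ℕ) (X : Type u) [AddCommGroup X]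
    [Module (R ⧸ A) X] (hX : HasInjectiveDimensionLT (ModuleCat.of (R ⧸ A) X) (n + 1)) :
    HasInjectiveDimensionLT ((ModuleCat.restrictScalars.{u} (Ideal.Quotient.mk A)).obj
      (ModuleCat.of (R ⧸ A) X)) (n + m + 1) := by
  induction n generalizing X with
  | zero =>
    rw [zero_add, ← injective_iff_hasInjectiveDimensionLT_one,
      ← Module.injective_iff_injective_object] at hX
    rw [zero_add]
    exact hasInjectiveDimensionLT_restrictScalars_of_injective A m h X hX
  | succ n ih =>
    obtain ⟨J, _, _, f, hJ, hf⟩ := exists_injective_shortExact (R := R ⧸ A) X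
    have hS := Function.Exact.shortExact (LinearMap.exact_map_mkQ_range f) hf
      (Submodule.mkQ_surjective _)
    have hJ' : Injective (ModuleCat.of (R ⧸ A) J) :=
      (Module.injective_iff_injective_object _ J).mp hJ
    have hC := ih _ ((hS.hasInjectiveDimensionLT_X₃_iff n hJ').mpr hX)
    have hS' := hS.map_of_exact (ModuleCat.restrictScalars.{u} (Ideal.Quotient.mk A))
    have h2 := hasInjectiveDimensionLT_restrictScalars_of_injective A m h J hJ
    have h3 := hS'.hasInjectiveDimensionLT_X₁ (n + m + 1) hC
      (@hasInjectiveDimensionLT_of_ge _ _ _ _ (m + 1) (n + m + 1 + 1) (by lia) h2)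
    rwa [show n + 1 + m + 1 = n + m + 1 + 1 by lia]

/-- The injective dimension over `R` of a module annihilated by `A` is at most
`gld (R ⧸ A) + pd (R ⧸ A)_R`. -/
lemma hasInjectiveDimensionLT_of_smul_eq_zero (s : ℕ)
    (hs : globalDim (R ⧸ A) + projectiveDimension (rightQuotient A) ≤ s) (X : Type u)
    [AddCommGroup X] [Module R X] (hX : ∀ a ∈ A, ∀ x : X, a • x = 0) :
    HasInjectiveDimensionLT (ModuleCat.of R X) (s + 1) := by
  have hX' : Module.IsTorsionBySet R X (A : Set R) := fun x a => hX a a.2 x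
  let _ : Module (R ⧸ A) X := hX'.module
  have hle : projectiveDimension (FGModuleCat.of (R ⧸ A) (R ⧸ A)).obj ≤ globalDim (R ⧸ A) :=
    le_iSup (fun M : FGModuleCat.{u} (R ⧸ A) => projectiveDimension M.obj) _
  -- For the zero quotient the bound is ⊥ and `hs` carries no information, but then X = 0. Otherwise
  -- neither dimension is ⊥, which would absorb the other, so both are natural numbers.
  rcases subsingleton_or_nontrivial (R ⧸ A) with hB | hB
  · have : Subsingleton X := Module.subsingleton (R ⧸ A) X
    have h0 : Limits.IsZero (ModuleCat.of R X) := ModuleCat.isZero_of_subsingleton _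
    have := h0.hasInjectiveDimensionLT_zero
    exact hasInjectiveDimensionLT_of_ge _ 0 _ (Nat.zero_le _)
  · have h1 : projectiveDimension (rightQuotient A) ≠ ⊥ := fun h => by
      have h0 := ModuleCat.subsingleton_of_isZero ((projectiveDimension_eq_bot_iff _).mp h)
      exact not_subsingleton_iff_nontrivial.mpr hB h0
    have h2 : globalDim (R ⧸ A) ≠ ⊥ := fun h => by
      rw [h, le_bot_iff] at hle
      have h0 := ModuleCat.subsingleton_of_isZero ((projectiveDimension_eq_bot_iff _).mp hle)
      exact not_subsingleton_iff_nontrivial.mpr hB h0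
    obtain ⟨g, hg⟩ := WithBot.ne_bot_iff_exists.mp h2
    obtain ⟨d, hd⟩ := WithBot.ne_bot_iff_exists.mp h1
    rw [← hg, ← hd] at hs
    have hs' : g + d ≤ (s : ℕ∞) := by exact_mod_cast hs
    obtain ⟨g, rfl⟩ := ENat.ne_top_iff_exists.mp
      (ne_top_of_le_ne_top (ENat.natCast_ne_top s) (le_self_add.trans hs'))
    obtain ⟨d, rfl⟩ := ENat.ne_top_iff_exists.mp
      (ne_top_of_le_ne_top (ENat.natCast_ne_top s) (le_add_self.trans hs'))
    have hs'' : g + d ≤ s := by exact_mod_cast hs'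
    have hd' : HasProjectiveDimensionLT (rightQuotient A) (d + 1) :=
      (projectiveDimension_le_iff _ d).mp hd.ge
    have hg' : HasInjectiveDimensionLT (ModuleCat.of (R ⧸ A) X) (g + 1) := by
      -- The global dimension only controls finitely generated modules, while X is arbitrary; cyclic
      -- test modules suffice.
      refine hasInjectiveDimensionLT_of_subsingleton_ext_quotient g X fun I => ?_
      have h3 : projectiveDimension (FGModuleCat.of (R ⧸ A) ((R ⧸ A) ⧸ I)).obj ≤ g :=
        (le_iSup (fun M : FGModuleCat.{u} (R ⧸ A) => projectiveDimension M.obj) _).trans hg.ge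
      have h4 := (projectiveDimension_le_iff _ g).mp h3
      exact HasProjectiveDimensionLT.subsingleton _ (g + 1) (g + 1) le_rfl _
    have h5 := hasInjectiveDimensionLT_restrictScalars A d hd' g X hg'
    have e : (ModuleCat.restrictScalars.{u} (Ideal.Quotient.mk A)).obj
        (ModuleCat.of (R ⧸ A) X) ≅ ModuleCat.of R X :=
      LinearEquiv.toModuleIso
        { AddEquiv.refl X with
          map_smul' := fun r x => rfl }
    have h6 := hasInjectiveDimensionLT_of_iso e (g + d + 1)
    exact hasInjectiveDimensionLT_of_ge _ (g + d + 1) _ (by lia)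

end Quotient

/-! ### Elementary properties of φ_r and the horseshoe argument -/

section PhiBasic

variable {R : Type u} [Ring R]

lemma mem_cosyzygyAdd_iff {M : FGModuleCat.{u} R} {s : ℕ} {x : KInj R} :
    x ∈ cosyzygyAdd M s ↔ ∃ y ∈ cosyzygyAdd M 0, (cosyzygyHom R)^[s] y = x := by
  induction s generalizing x with
  | zero => simp
  | succ s ih =>
    have hs : x ∈ cosyzygyAdd M (s + 1) ↔ ∃ z ∈ cosyzygyAdd M s, cosyzygyHom R z = x := Iff.rfl
    rw [hs]
    constructor
    · rintro ⟨z, hz, rfl⟩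
      obtain ⟨y, hy, rfl⟩ := ih.mp hz
      exact ⟨y, hy, Function.iterate_succ_apply' _ _ _⟩
    · rintro ⟨y, hy, rfl⟩
      exact ⟨_, ih.mpr ⟨y, hy, rfl⟩, (Function.iterate_succ_apply' _ _ _).symm⟩

/-- Surjectivity is built into the definition of the next subgroup as an image, so only the kernel
matters. -/
lemma bijOn_cosyzygyHom_iff {M : FGModuleCat.{u} R} {s : ℕ} :
    Set.BijOn (cosyzygyHom R) (cosyzygyAdd M s) (cosyzygyAdd M (s + 1)) ↔
      ∀ x ∈ cosyzygyAdd M s, cosyzygyHom R x = 0 → x = 0 := by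
  constructor
  · intro h x hx h0
    exact h.injOn hx (zero_mem _) (h0.trans (map_zero _).symm)
  · intro h
    refine ⟨fun x hx => ⟨x, hx, rfl⟩, fun x hx y hy hxy => ?_, fun x hx => hx⟩
    exact sub_eq_zero.mp (h _ (sub_mem hx hy) (by rw [map_sub, hxy, sub_self]))

/-- The set of admissible n is closed upwards, so its infimum is at most n exactly when n is
admissible. -/
lemma phiR_le_iff {M : FGModuleCat.{u} R} {n : ℕ} :
    phiR M ≤ n ↔ ∀ s, n ≤ s → ∀ x ∈ cosyzygyAdd M s, cosyzygyHom R x = 0 → x = 0 := by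
  constructor
  · intro h
    by_cases hne : ∃ m : ℕ, m ≤ n ∧ ∀ s : ℕ, m ≤ s → Set.BijOn (cosyzygyHom R)
        (cosyzygyAdd M s) (cosyzygyAdd M (s + 1))
    · obtain ⟨m, hm, hm'⟩ := hne
      exact fun s hs => bijOn_cosyzygyHom_iff.mp (hm' s (hm.trans hs))
    · exfalso
      push Not at hne
      have : ((n + 1 : ℕ) : ℕ∞) ≤ phiR M := le_iInf₂ fun m hm => by
        by_contra hlt
        have h1 : m ≤ n := by
          rw [not_le] at hlt
          have : m < n + 1 := by exact_mod_cast hlt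
          lia
        obtain ⟨s, hs, hs'⟩ := hne m h1
        exact hs' (hm s hs)
      have h2 := this.trans h
      have : n + 1 ≤ n := by exact_mod_cast h2
      lia
  · intro h
    exact iInf₂_le n fun s hs => bijOn_cosyzygyHom_iff.mpr (h s hs)

/-- If `Ω⁻ˢ⟨add T⟩ ⊆ Ω⁻ˢ⟨add Y⟩` then `φ_r(T) ≤ max(s, φ_r(Y))`. -/
lemma phiR_le_max_of_forall_mem {T Y : FGModuleCat.{u} R} (s : ℕ)
    (h : ∀ X W : FGModuleCat.{u} R, Nonempty (T ≃ₗ[R] X × W) →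
      (cosyzygyHom R)^[s] (kClass X) ∈ cosyzygyAdd Y s) :
    phiR T ≤ max (s : ℕ∞) (phiR Y) := by
  have h0 : cosyzygyAdd T s ≤ cosyzygyAdd Y s := by
    intro x hx
    obtain ⟨y, hy, rfl⟩ := mem_cosyzygyAdd_iff.mp hx
    let Ω : KInj R →+ KInj R :=
      { toFun := (cosyzygyHom R)^[s]
        map_zero' := iterate_map_zero _ s
        map_add' := iterate_map_add _ s }
    have hle : cosyzygyAdd T 0 ≤ (cosyzygyAdd Y s).comap Ω := by
      refine (AddSubgroup.closure_le _).mpr ?_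
      rintro _ ⟨X, W, -, e, rfl⟩
      exact h X W e
    exact hle hy
  have hst : ∀ t, s ≤ t → cosyzygyAdd T t ≤ cosyzygyAdd Y t := by
    intro t ht
    induction t, ht using Nat.le_induction with
    | base => exact h0
    | succ t _ ih => exact AddSubgroup.map_mono ih
  rcases eq_or_ne (phiR Y) ⊤ with hY | hY
  · simp [hY]
  · obtain ⟨n, hn⟩ := ENat.ne_top_iff_exists.mp hY
    rw [← hn, ← Nat.mono_cast.map_max, phiR_le_iff]
    intro t ht x hx
    exact phiR_le_iff.mp hn.ge t ((le_max_right _ _).trans ht) x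
      (hst t ((le_max_left _ _).trans ht) hx)

/-- A short exact sequence with injective first term splits. -/
lemma Module.Injective.nonempty_linearEquiv_prod {X T Y : Type u} [AddCommGroup X] [Module R X]
    [AddCommGroup T] [Module R T] [AddCommGroup Y] [Module R Y] (hX : Module.Injective R X)
    {f : X →ₗ[R] T} {g : T →ₗ[R] Y} (hf : Function.Injective f) (hfg : Function.Exact f g)
    (hg : Function.Surjective g) : Nonempty (T ≃ₗ[R] X × Y) := by
  obtain ⟨r, hr⟩ := hX.out f hf LinearMap.id
  have hr' : ∀ x, r (f x) = x := hr
  refine ⟨LinearEquiv.ofBijective (r.prod g) ⟨?_, fun ⟨x, y⟩ => ?_⟩⟩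
  · rw [← LinearMap.ker_eq_bot, eq_bot_iff]
    intro t ht
    have h1 : r t = 0 := congrArg Prod.fst (LinearMap.mem_ker.mp ht)
    have h2 : g t = 0 := congrArg Prod.snd (LinearMap.mem_ker.mp ht)
    obtain ⟨x, rfl⟩ := (hfg t).mp h2
    rw [hr'] at h1
    simp [h1]
  · obtain ⟨t, rfl⟩ := hg y
    exact ⟨t + f (x - r t), Prod.ext (by simp [hr']) (by simp [hfg.apply_apply_eq_zero])⟩

/-- The horseshoe lemma for one step of injective coresolutions. -/
lemma exists_horseshoe {X T Y : FGModuleCat.{u} R} {f : X →ₗ[R] T} {g : T →ₗ[R] Y}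
    (hf : Function.Injective f) (hfg : Function.Exact f g) (hg : Function.Surjective g)
    {I J : FGModuleCat.{u} R} {ι : X →ₗ[R] I} {κ : Y →ₗ[R] J} (hI : Module.Injective R I)
    (hJ : Module.Injective R J) (hι : Function.Injective ι) (hκ : Function.Injective κ) :
    ∃ (T' : FGModuleCat.{u} R) (a : (I ⧸ LinearMap.range ι) →ₗ[R] T')
      (b : T' →ₗ[R] J ⧸ LinearMap.range κ), IsCosyzygy T T' ∧ Function.Injective a ∧
      Function.Exact a b ∧ Function.Surjective b := by
  obtain ⟨α, hα⟩ := hI.out f hf ι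
  -- The extension `α` of ι to T, paired with κ ∘ g, embeds T in I × J.
  let m : T →ₗ[R] I × J := α.prod (κ ∘ₗ g)
  have hm : Function.Injective m := by
    rw [← LinearMap.ker_eq_bot, eq_bot_iff]
    intro t ht
    have h1 : α t = 0 := congrArg Prod.fst (LinearMap.mem_ker.mp ht)
    have h2 : κ (g t) = 0 := congrArg Prod.snd (LinearMap.mem_ker.mp ht)
    obtain ⟨x, rfl⟩ := (hfg t).mp (hκ (h2.trans (map_zero κ).symm))
    rw [hα] at h1
    have : x = 0 := hι (h1.trans (map_zero ι).symm)
    simp [this]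
  let a : (I ⧸ LinearMap.range ι) →ₗ[R] (I × J) ⧸ LinearMap.range m :=
    Submodule.mapQ _ _ (LinearMap.inl R I J) (by
      rintro _ ⟨x, rfl⟩
      exact ⟨f x, Prod.ext (hα x) (by simp [m, hfg.apply_apply_eq_zero])⟩)
  let b : ((I × J) ⧸ LinearMap.range m) →ₗ[R] J ⧸ LinearMap.range κ :=
    Submodule.mapQ _ _ (LinearMap.snd R I J) (by
      rintro _ ⟨t, rfl⟩
      exact ⟨g t, rfl⟩)
  refine ⟨FGModuleCat.of R ((I × J) ⧸ LinearMap.range m), a, b,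
    ⟨FGModuleCat.of R (I × J), m, (LinearMap.range m).mkQ, ?_, hm,
      LinearMap.exact_map_mkQ_range m, Submodule.mkQ_surjective _⟩, ?_, ?_, ?_⟩
  · refine ⟨fun X Y _ _ _ _ i hi h => ?_⟩
    obtain ⟨s, hs⟩ := hI.out i hi ((LinearMap.fst R I J).comp h)
    obtain ⟨t, ht⟩ := hJ.out i hi ((LinearMap.snd R I J).comp h)
    exact ⟨s.prod t, fun x => Prod.ext (hs x) (ht x)⟩
  · rw [← LinearMap.ker_eq_bot, eq_bot_iff]
    intro x hx
    obtain ⟨i, rfl⟩ := Submodule.mkQ_surjective _ x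
    have h1 : ((i, 0) : I × J) ∈ LinearMap.range m :=
      (Submodule.Quotient.mk_eq_zero _).mp (LinearMap.mem_ker.mp hx)
    obtain ⟨t, ht⟩ := h1
    have h2 : α t = i := congrArg Prod.fst ht
    have h3 : κ (g t) = 0 := congrArg Prod.snd ht
    obtain ⟨x, rfl⟩ := (hfg t).mp (hκ (h3.trans (map_zero κ).symm))
    rw [hα] at h2
    exact (Submodule.Quotient.mk_eq_zero _).mpr ⟨x, h2⟩
  · intro z
    obtain ⟨⟨i, j⟩, rfl⟩ := Submodule.mkQ_surjective _ z
    constructor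
    · intro hz
      have h1 : j ∈ LinearMap.range κ := (Submodule.Quotient.mk_eq_zero _).mp hz
      obtain ⟨y, rfl⟩ := h1
      obtain ⟨t, rfl⟩ := hg y
      refine ⟨Submodule.Quotient.mk (i - α t), ?_⟩
      refine (Submodule.Quotient.eq _).mpr ⟨-t, ?_⟩
      exact Prod.ext (by simp [m]) (by simp [m])
    · rintro ⟨x, hx⟩
      rw [← hx]
      obtain ⟨i, rfl⟩ := Submodule.mkQ_surjective _ x
      change (Submodule.Quotient.mk (0 : J) : J ⧸ LinearMap.range κ) = 0
      simp
  · intro z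
    obtain ⟨j, rfl⟩ := Submodule.mkQ_surjective _ z
    exact ⟨Submodule.Quotient.mk (0, j), rfl⟩

/-- If the first term of a short exact sequence has injective dimension at most `s`, then the
other two have the same class after `s` cosyzygies. -/
lemma iterate_cosyzygyHom_kClass_eq (h : EnoughInjectivesFG R) (s : ℕ) {X T Y : FGModuleCat.{u} R}
    {f : X →ₗ[R] T} {g : T →ₗ[R] Y} (hf : Function.Injective f) (hfg : Function.Exact f g)
    (hg : Function.Surjective g) (hX : HasInjectiveDimensionLT (ModuleCat.of R X) (s + 1)) :
    (cosyzygyHom R)^[s] (kClass T) = (cosyzygyHom R)^[s] (kClass Y) := by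
  induction s generalizing X T Y with
  | zero =>
    rw [zero_add, ← injective_iff_hasInjectiveDimensionLT_one,
      ← Module.injective_iff_injective_object] at hX
    obtain ⟨e⟩ := hX.nonempty_linearEquiv_prod hf hfg hg
    simp [kClass_add e, kClass_injective X hX]
  | succ s ih =>
    obtain ⟨-, I, ι, -, hI, hι, -⟩ := h X
    obtain ⟨-, J, κ, -, hJ, hκ, -⟩ := h Y
    -- The cosyzygies again form a short exact sequence, with the bound on the injective dimension
    -- of the first term lowered by one.
    obtain ⟨T', a, b, hT, ha, hab, hb⟩ := exists_horseshoe hf hfg hg hI hJ hι hκ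
    have hY : IsCosyzygy Y (FGModuleCat.of R (J ⧸ LinearMap.range κ)) :=
      ⟨J, κ, _, hJ, hκ, LinearMap.exact_map_mkQ_range κ, Submodule.mkQ_surjective _⟩
    have hS := (LinearMap.exact_map_mkQ_range ι).shortExact hι (Submodule.mkQ_surjective _)
    have hX' := (hS.hasInjectiveDimensionLT_X₃_iff s
      ((Module.injective_iff_injective_object R I).mp hI)).mpr hX
    rw [Function.iterate_succ_apply, Function.iterate_succ_apply, cosyzygyHom_kClass h hT,
      cosyzygyHom_kClass h hY]
    exact ih (X := FGModuleCat.of R (I ⧸ LinearMap.range ι)) ha hab hb hX'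

end PhiBasic

/-! ### The trace of the quotient ring, and the comparison for part (a) -/

section Trace

variable {R : Type u} [Ring R] (A : Ideal R)

/-- Homomorphisms from R ⧸ A correspond to elements killed by A; as A is two-sided, these elements
already form a submodule. -/
lemma mem_moduleTrace_quotient_iff {T : Type u} [AddCommGroup T] [Module R T] [A.IsTwoSided]
    {t : T} : t ∈ moduleTrace R (R ⧸ A) T ↔ ∀ a ∈ A, a • t = 0 := by
  constructor
  · intro ht a ha
    have hle : moduleTrace R (R ⧸ A) T ≤
        { carrier := {t | ∀ a ∈ A, a • t = 0}
          zero_mem' := fun a _ => smul_zero a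
          add_mem' := fun {x y} hx hy a ha => by rw [smul_add, hx a ha, hy a ha, add_zero]
          smul_mem' := fun r x hx a ha => by
            rw [smul_smul]; exact hx _ (A.mul_mem_right r ha) } := by
      refine iSup_le fun f => ?_
      rintro _ ⟨x, rfl⟩ a ha
      obtain ⟨r, rfl⟩ := Submodule.mkQ_surjective _ x
      rw [← map_smul, ← map_smul]
      have : (A.mkQ (a • r)) = 0 :=
        (Submodule.Quotient.mk_eq_zero A).mpr (A.mul_mem_right r ha)
      rw [this, map_zero]
    exact hle ht a ha
  · intro ht
    have h1 : LinearMap.range (Submodule.liftQ A (LinearMap.toSpanSingleton R T t) ht) ≤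
        moduleTrace R (R ⧸ A) T :=
      le_iSup (fun f : (R ⧸ A) →ₗ[R] T => LinearMap.range f) _
    exact h1 ⟨Submodule.Quotient.mk 1, one_smul R t⟩

/-- The torsion-free quotient of a direct sum. -/
lemma nonempty_quotient_moduleTrace_prod {T X W : Type u} [A.IsTwoSided] [AddCommGroup T]
    [Module R T] [AddCommGroup X] [Module R X] [AddCommGroup W] [Module R W]
    (e : T ≃ₗ[R] X × W) : Nonempty ((T ⧸ moduleTrace R (R ⧸ A) T) ≃ₗ[R]
      (X ⧸ moduleTrace R (R ⧸ A) X) × (W ⧸ moduleTrace R (R ⧸ A) W)) := by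
  let p : T →ₗ[R] (X ⧸ moduleTrace R (R ⧸ A) X) × (W ⧸ moduleTrace R (R ⧸ A) W) :=
    (Submodule.mkQ _).prodMap (Submodule.mkQ _) ∘ₗ e.toLinearMap
  have hp : Function.Surjective p :=
    (Function.Surjective.prodMap (Submodule.mkQ_surjective _) (Submodule.mkQ_surjective _)).comp
      e.surjective
  have hk : moduleTrace R (R ⧸ A) T = LinearMap.ker p := by
    ext t
    have h1 : p t = (Submodule.Quotient.mk (e t).1, Submodule.Quotient.mk (e t).2) := rfl
    rw [LinearMap.mem_ker, h1, Prod.mk_eq_zero, Submodule.Quotient.mk_eq_zero,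
      Submodule.Quotient.mk_eq_zero, mem_moduleTrace_quotient_iff, mem_moduleTrace_quotient_iff,
      mem_moduleTrace_quotient_iff]
    constructor
    · intro h
      have h2 : ∀ a ∈ A, a • e t = 0 := fun a ha => by rw [← map_smul, h a ha, map_zero]
      exact ⟨fun a ha => congrArg Prod.fst (h2 a ha), fun a ha => congrArg Prod.snd (h2 a ha)⟩
    · rintro ⟨h2, h3⟩ a ha
      apply e.injective
      rw [map_smul, map_zero]
      exact Prod.ext (h2 a ha) (h3 a ha)
  exact ⟨Submodule.quotEquivOfEq _ _ hk ≪≫ₗ p.quotKerEquivOfSurjective hp⟩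

/-- The comparison of `φ_r(T)` and `φ_r(T / τ_{R ⧸ A} T)`. -/
lemma phiR_le_max_phiR_quotient [IsNoetherianRing R] [IsArtinianRing R] [A.IsTwoSided]
    (h : EnoughInjectivesFG R) (s : ℕ)
    (hs : globalDim (R ⧸ A) + projectiveDimension (rightQuotient A) ≤ s) (T : FGModuleCat.{u} R) :
    phiR T ≤ max (s : ℕ∞) (phiR (FGModuleCat.of R (T ⧸ moduleTrace R (R ⧸ A) T))) := by
  refine phiR_le_max_of_forall_mem s ?_
  rintro X W ⟨e⟩
  -- Applied to every summand X of T: Ω⁻ˢ identifies [X] with [X/τX], and X/τX is a summand of T/τT.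
  have hX := hasInjectiveDimensionLT_of_smul_eq_zero A s hs (moduleTrace R (R ⧸ A) X)
    fun a ha x => Subtype.ext ((mem_moduleTrace_quotient_iff A).mp x.2 a ha)
  have h1 := iterate_cosyzygyHom_kClass_eq h s
    (X := FGModuleCat.of R (moduleTrace R (R ⧸ A) X)) (T := X)
    (Y := FGModuleCat.of R (X ⧸ moduleTrace R (R ⧸ A) X))
    (Submodule.injective_subtype _) (LinearMap.exact_subtype_mkQ _) (Submodule.mkQ_surjective _) hX
  rw [h1]
  obtain ⟨f⟩ := nonempty_quotient_moduleTrace_prod A e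
  exact mem_cosyzygyAdd_iff.mpr ⟨_, kClass_mem_cosyzygyAdd_zero
    (X := FGModuleCat.of R (X ⧸ moduleTrace R (R ⧸ A) X))
    (Y := FGModuleCat.of R (W ⧸ moduleTrace R (R ⧸ A) W)) f, rfl⟩

end Trace

/-! ### The functors Hom_R(P, -) and Hom_Γ(Hom_R(P, R), -) -/

section HomFunctors

variable (R : Type u) [Ring R] (P : Type u) [AddCommGroup P] [Module R P]

/-- The group `Hom_R(P, M)` as a left module over `End_R(P)ᵒᵖ`. -/
def HomFrom (M : Type u) [AddCommGroup M] [Module R M] : Type u := P →ₗ[R] M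

namespace HomFrom

variable {R P} {M N K : Type u} [AddCommGroup M] [Module R M] [AddCommGroup N] [Module R N]
  [AddCommGroup K] [Module R K]

instance : AddCommGroup (HomFrom R P M) := inferInstanceAs (AddCommGroup (P →ₗ[R] M))

instance : FunLike (HomFrom R P M) P M := inferInstanceAs (FunLike (P →ₗ[R] M) P M)

instance : LinearMapClass (HomFrom R P M) R P M :=
  inferInstanceAs (LinearMapClass (P →ₗ[R] M) R P M)

instance : Module (Module.End R P)ᵐᵒᵖ (HomFrom R P M) where
  smul e f := LinearMap.comp f e.unop
  one_smul _ := rfl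
  mul_smul _ _ _ := rfl
  smul_zero _ := rfl
  smul_add _ _ _ := rfl
  add_smul e e' f := LinearMap.ext fun p => map_add f (e.unop p) (e'.unop p)
  zero_smul f := LinearMap.ext fun _ => map_zero f

lemma ext {f g : HomFrom R P M} (h : ∀ p, f p = g p) : f = g := LinearMap.ext h

lemma smul_apply (e : (Module.End R P)ᵐᵒᵖ) (f : HomFrom R P M) (p : P) :
    (e • f) p = f (e.unop p) := rfl

lemma add_apply (f g : HomFrom R P M) (p : P) : (f + g) p = f p + g p := rfl

lemma sum_apply {ι : Type*} (s : Finset ι) (f : ι → HomFrom R P M) (p : P) :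
    (∑ i ∈ s, f i) p = ∑ i ∈ s, f i p := LinearMap.sum_apply s f p

variable (P) in
/-- The functor `Hom_R(P, -)` on morphisms. -/
def map (g : M →ₗ[R] N) : HomFrom R P M →ₗ[(Module.End R P)ᵐᵒᵖ] HomFrom R P N where
  toFun f := LinearMap.comp g f
  map_add' _ _ := LinearMap.ext fun _ => map_add g _ _
  map_smul' _ _ := rfl

lemma map_apply (g : M →ₗ[R] N) (f : HomFrom R P M) (p : P) : map P g f p = g (f p) := rfl

lemma map_injective {g : M →ₗ[R] N} (hg : Function.Injective g) :
    Function.Injective (map P g) := fun _ _ hfh => ext fun p => hg (DFunLike.congr_fun hfh p)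

lemma map_surjective [Module.Projective R P] {g : M →ₗ[R] N} (hg : Function.Surjective g) :
    Function.Surjective (map P g) := fun f => by
  obtain ⟨h, hh⟩ := Module.projective_lifting_property g f hg
  exact ⟨h, hh⟩

lemma map_exact {f : K →ₗ[R] M} {g : M →ₗ[R] N} (hf : Function.Injective f)
    (hfg : Function.Exact f g) : Function.Exact (map P f) (map P g) := by
  intro h
  constructor
  · intro hh
    have hmem : ∀ p, h p ∈ LinearMap.range f := fun p =>
      (hfg (h p)).mp (DFunLike.congr_fun hh p)
    refine ⟨(LinearEquiv.ofInjective f hf).symm.toLinearMap ∘ₗ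
      LinearMap.codRestrict (LinearMap.range f) h hmem, ext fun p => ?_⟩
    have := (LinearEquiv.ofInjective f hf).apply_symm_apply ⟨h p, hmem p⟩
    exact congrArg Subtype.val this
  · rintro ⟨l, rfl⟩
    exact ext fun p => hfg.apply_apply_eq_zero (l p)

/-- `Hom_R(P, -)` preserves binary products. -/
def prodEquiv (e : K ≃ₗ[R] M × N) :
    HomFrom R P K ≃ₗ[(Module.End R P)ᵐᵒᵖ] HomFrom R P M × HomFrom R P N where
  toFun f := (map P (LinearMap.fst R M N ∘ₗ e.toLinearMap) f,
    map P (LinearMap.snd R M N ∘ₗ e.toLinearMap) f)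
  map_add' f g := Prod.ext (map_add _ f g) (map_add _ f g)
  map_smul' r f := Prod.ext (map_smul _ r f) (map_smul _ r f)
  invFun x := map P e.symm.toLinearMap (LinearMap.prod x.1 x.2 : P →ₗ[R] M × N)
  left_inv f := ext fun p => e.symm_apply_apply (f p)
  right_inv x := Prod.ext (ext fun p => congrArg Prod.fst (e.apply_symm_apply (x.1 p, x.2 p)))
    (ext fun p => congrArg Prod.snd (e.apply_symm_apply (x.1 p, x.2 p)))

/-- Right multiplication of a homomorphism `P → R` by an element of `R`. -/
def mulRight (f : HomFrom R P R) (r : R) : HomFrom R P R where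
  toFun p := f p * r
  map_add' p q := by rw [map_add, add_mul]
  map_smul' a p := by rw [map_smul, smul_eq_mul, smul_eq_mul, mul_assoc]; rfl

lemma mulRight_apply (f : HomFrom R P R) (r : R) (p : P) : mulRight f r p = f p * r := rfl

/-- The homomorphism `p ↦ f(p) • x`. -/
def smulRight (f : HomFrom R P R) (x : M) : HomFrom R P M where
  toFun p := f p • x
  map_add' p q := by rw [map_add, add_smul]
  map_smul' a p := by rw [map_smul, smul_eq_mul, mul_smul]; rfl

end HomFrom

/-- The group `Hom_Γ(Hom_R(P, R), N)`, for `Γ = End_R(P)ᵒᵖ`, as a left `R`-module. -/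
def DualHom (N : Type u) [AddCommGroup N] [Module (Module.End R P)ᵐᵒᵖ N] : Type u :=
  HomFrom R P R →ₗ[(Module.End R P)ᵐᵒᵖ] N

namespace DualHom

variable {R P} {N N' K : Type u} [AddCommGroup N] [Module (Module.End R P)ᵐᵒᵖ N]
  [AddCommGroup N'] [Module (Module.End R P)ᵐᵒᵖ N'] [AddCommGroup K]
  [Module (Module.End R P)ᵐᵒᵖ K] {M : Type u} [AddCommGroup M] [Module R M]

instance : AddCommGroup (DualHom R P N) :=
  inferInstanceAs (AddCommGroup (HomFrom R P R →ₗ[(Module.End R P)ᵐᵒᵖ] N))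

instance : FunLike (DualHom R P N) (HomFrom R P R) N :=
  inferInstanceAs (FunLike (HomFrom R P R →ₗ[(Module.End R P)ᵐᵒᵖ] N) _ _)

instance : LinearMapClass (DualHom R P N) (Module.End R P)ᵐᵒᵖ (HomFrom R P R) N :=
  inferInstanceAs (LinearMapClass (HomFrom R P R →ₗ[(Module.End R P)ᵐᵒᵖ] N) _ _ _)

/-- Right multiplication on `Hom_R(P, R)` as a linear map. -/
def _root_.HomFrom.mulRightLinear (r : R) :
    HomFrom R P R →ₗ[(Module.End R P)ᵐᵒᵖ] HomFrom R P R where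
  toFun f := f.mulRight r
  map_add' f g := HomFrom.ext fun p => add_mul (f p) (g p) r
  map_smul' _ _ := rfl

instance : Module R (DualHom R P N) where
  smul r φ := LinearMap.comp φ (HomFrom.mulRightLinear r)
  one_smul φ := LinearMap.ext fun f => congrArg φ (HomFrom.ext fun p => mul_one (f p))
  mul_smul r s φ := LinearMap.ext fun f => congrArg φ
    (HomFrom.ext fun p => (mul_assoc (f p) r s).symm)
  smul_zero _ := rfl
  smul_add _ _ _ := rfl
  add_smul r s φ := LinearMap.ext fun f => by
    have : f.mulRight (r + s) = f.mulRight r + f.mulRight s :=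
      HomFrom.ext fun p => mul_add (f p) r s
    exact (congrArg φ this).trans (map_add φ _ _)
  zero_smul φ := LinearMap.ext fun f =>
    (congrArg φ (HomFrom.ext fun p => mul_zero (f p) : f.mulRight 0 = 0)).trans (map_zero φ)

lemma ext {φ ψ : DualHom R P N} (h : ∀ f, φ f = ψ f) : φ = ψ := LinearMap.ext h

lemma smul_apply (r : R) (φ : DualHom R P N) (f : HomFrom R P R) :
    (r • φ) f = φ (f.mulRight r) := rfl

lemma sum_apply {ι : Type*} (s : Finset ι) (φ : ι → DualHom R P N) (f : HomFrom R P R) :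
    (∑ i ∈ s, φ i) f = ∑ i ∈ s, φ i f := LinearMap.sum_apply s φ f

/-- The functor `Hom_Γ(Hom_R(P, R), -)` on morphisms. -/
def map (g : N →ₗ[(Module.End R P)ᵐᵒᵖ] N') : DualHom R P N →ₗ[R] DualHom R P N' where
  toFun φ := LinearMap.comp g φ
  map_add' φ ψ := LinearMap.ext fun f => map_add g (φ f) (ψ f)
  map_smul' _ _ := rfl

lemma map_apply (g : N →ₗ[(Module.End R P)ᵐᵒᵖ] N') (φ : DualHom R P N) (f : HomFrom R P R) :
    map g φ f = g (φ f) := rfl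

lemma map_injective {g : N →ₗ[(Module.End R P)ᵐᵒᵖ] N'} (hg : Function.Injective g) :
    Function.Injective (map g) := fun _ _ h => ext fun f => hg (DFunLike.congr_fun h f)

/-- `Hom_Γ(Hom_R(P, R), -)` preserves binary products. -/
def prodEquiv (e : K ≃ₗ[(Module.End R P)ᵐᵒᵖ] N × N') :
    DualHom R P K ≃ₗ[R] DualHom R P N × DualHom R P N' where
  toFun φ := (map (LinearMap.fst _ N N' ∘ₗ e.toLinearMap) φ,
    map (LinearMap.snd _ N N' ∘ₗ e.toLinearMap) φ)
  map_add' φ ψ := Prod.ext (map_add _ φ ψ) (map_add _ φ ψ)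
  map_smul' r φ := Prod.ext (map_smul _ r φ) (map_smul _ r φ)
  invFun x := map e.symm.toLinearMap
    (LinearMap.prod x.1 x.2 : HomFrom R P R →ₗ[(Module.End R P)ᵐᵒᵖ] N × N')
  left_inv φ := ext fun f => e.symm_apply_apply (φ f)
  right_inv x := Prod.ext (ext fun f => congrArg Prod.fst (e.apply_symm_apply (x.1 f, x.2 f)))
    (ext fun f => congrArg Prod.snd (e.apply_symm_apply (x.1 f, x.2 f)))

variable (P) in
/-- The unit `M → Hom_Γ(Hom_R(P, R), Hom_R(P, M))`. -/
def unit : M →ₗ[R] DualHom R P (HomFrom R P M) where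
  toFun m :=
    { toFun := fun f => f.smulRight m
      map_add' := fun f g => HomFrom.ext fun p => add_smul (f p) (g p) m
      map_smul' := fun _ _ => rfl }
  map_add' m m' := ext fun f => HomFrom.ext fun p => smul_add (f p) m m'
  map_smul' r m := ext fun f => HomFrom.ext fun p => (mul_smul (f p) r m).symm

/-- The endomorphism q ↦ f'(q)p of P sends f to f'·f(p), and w is linear over it. Consequently the
trace ideal of P multiplies the target of the unit into its image. -/
lemma smul_eq_unit (w : DualHom R P (HomFrom R P M)) (f : HomFrom R P R) (p : P) :
    f p • w = unit P (w f p) := by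
  refine ext fun f' => HomFrom.ext fun q => ?_
  let e : (Module.End R P)ᵐᵒᵖ := MulOpposite.op (f'.smulRight p : P →ₗ[R] P)
  have h : f'.mulRight (f p) = e • f := HomFrom.ext fun q => (map_smul f (f' q) p).symm
  rw [smul_apply, h, map_smul]
  exact map_smul (w f) (f' q) p

end DualHom

variable {R P}

/-- Elements of `M` annihilated by the ideal `A` vanish. -/
def IsTorsionFreeFor (A : Ideal R) (M : Type u) [AddCommGroup M] [Module R M] : Prop :=
  ∀ m : M, (∀ a ∈ A, a • m = 0) → m = 0

lemma smul_eq_zero_of_moduleTrace {A : Ideal R} (hA : moduleTrace R P R = A) {M : Type u}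
    [AddCommGroup M] [Module R M] {m : M} (h : ∀ (f : HomFrom R P R) (p : P), f p • m = 0) :
    ∀ a ∈ A, a • m = 0 := by
  have hle : moduleTrace R P R ≤ LinearMap.ker (LinearMap.toSpanSingleton R M m) :=
    iSup_le fun f => by
      rintro _ ⟨p, rfl⟩
      exact h f p
  intro a ha
  exact hle (hA.symm ▸ ha)

lemma apply_mem_of_moduleTrace {A : Ideal R} (hA : moduleTrace R P R = A) (f : HomFrom R P R)
    (p : P) : f p ∈ A := by
  have : LinearMap.range f ≤ moduleTrace R P R :=
    le_iSup (fun f : P →ₗ[R] R => LinearMap.range f) f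
  exact hA ▸ this ⟨p, rfl⟩

/-- An element of the kernel is killed by all f(p), and these generate A. -/
lemma DualHom.unit_injective {A : Ideal R} (hA : moduleTrace R P R = A) {M : Type u}
    [AddCommGroup M] [Module R M] (hM : IsTorsionFreeFor A M) :
    Function.Injective (DualHom.unit P : M →ₗ[R] _) := by
  rw [← LinearMap.ker_eq_bot, eq_bot_iff]
  intro m hm
  refine hM m (smul_eq_zero_of_moduleTrace hA fun f p => ?_)
  exact DFunLike.congr_fun (DFunLike.congr_fun (LinearMap.mem_ker.mp hm) f) p

variable (R P) in
/-- A finite dual basis. -/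
lemma exists_dual_basis [Module.Projective R P] [Module.Finite R P] :
    ∃ (n : ℕ) (f : Fin n → HomFrom R P R) (b : Fin n → P), ∀ p, ∑ i, f i p • b i = p := by
  obtain ⟨n, s, t, -, -, hst⟩ := Module.Finite.exists_comp_eq_id_of_projective R P
  refine ⟨n, fun i => LinearMap.proj i ∘ₗ t, fun i => s fun j => if i = j then 1 else 0,
    fun p => ?_⟩
  have h1 := LinearMap.congr_fun hst p
  conv_rhs => rw [← LinearMap.id_apply (R := R) p, ← h1]
  rw [LinearMap.comp_apply, LinearMap.pi_apply_eq_sum_univ s (t p)]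
  rfl

lemma HomFrom.sum_mulRight {n : ℕ} {f : Fin n → HomFrom R P R} {b : Fin n → P}
    (h : ∀ p, ∑ i, f i p • b i = p) (g : HomFrom R P R) : ∑ i, (f i).mulRight (g (b i)) = g := by
  refine HomFrom.ext fun p => ?_
  rw [HomFrom.sum_apply]
  conv_rhs => rw [← h p, map_sum]
  exact Finset.sum_congr rfl fun i _ => (map_smul g (f i p) (b i)).symm

/-- A dual basis writes g as the sum of the f_i·g(b_i) with g(b_i) in A, and φ(f_i·a) = (aφ)(f_i)
vanishes when A kills φ. -/
lemma DualHom.isTorsionFreeFor [Module.Projective R P] [Module.Finite R P] {A : Ideal R}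
    (hA : moduleTrace R P R = A) (N : Type u) [AddCommGroup N]
    [Module (Module.End R P)ᵐᵒᵖ N] : IsTorsionFreeFor A (DualHom R P N) := by
  obtain ⟨n, f, b, h⟩ := exists_dual_basis R P
  intro φ hφ
  refine DualHom.ext fun g => ?_
  rw [← HomFrom.sum_mulRight h g, map_sum]
  refine Finset.sum_eq_zero fun i _ => ?_
  rw [← DualHom.smul_apply, hφ _ (apply_mem_of_moduleTrace hA g (b i))]
  rfl

/-- The unit is bijective on torsion-free modules to which homomorphisms from `A` extend. -/
lemma DualHom.unit_bijective [Module.Projective R P] [Module.Finite R P] {A : Ideal R}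
    (hA : moduleTrace R P R = A) {M : Type u} [AddCommGroup M] [Module R M]
    (hM : IsTorsionFreeFor A M)
    (hext : ∀ g : A →ₗ[R] M, ∃ g' : R →ₗ[R] M, ∀ (x : R) (hx : x ∈ A), g' x = g ⟨x, hx⟩) :
    Function.Bijective (DualHom.unit P : M →ₗ[R] _) := by
  have hinj := DualHom.unit_injective hA hM
  refine ⟨hinj, fun w => ?_⟩
  -- Since Aw lies in the image of the unit, a ↦ aw lifts to a map A → M, which extends to R. The
  -- image of its value at 1 differs from w by an element killed by A, hence equals w.
  have hmem : A ≤ (LinearMap.range (DualHom.unit P : M →ₗ[R] _)).comap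
      (LinearMap.toSpanSingleton R _ w) := by
    rw [← hA]
    refine iSup_le fun f => ?_
    rintro _ ⟨p, rfl⟩
    exact ⟨w f p, (DualHom.smul_eq_unit w f p).symm⟩
  let g : A →ₗ[R] M := (LinearEquiv.ofInjective _ hinj).symm.toLinearMap ∘ₗ
    LinearMap.codRestrict (LinearMap.range (DualHom.unit P : M →ₗ[R] _))
      (LinearMap.toSpanSingleton R _ w ∘ₗ A.subtype) fun a => hmem a.2
  have hg : ∀ a : A, DualHom.unit P (g a) = (a : R) • w := fun a =>
    congrArg Subtype.val ((LinearEquiv.ofInjective _ hinj).apply_symm_apply ⟨(a : R) • w, hmem a.2⟩)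
  obtain ⟨g', hg'⟩ := hext g
  refine ⟨g' 1, (sub_eq_zero.mp (DualHom.isTorsionFreeFor hA _ _ fun a ha => ?_)).symm⟩
  have h1 : a • g' 1 = g ⟨a, ha⟩ := by rw [← map_smul, smul_eq_mul, mul_one, hg' a ha]
  rw [smul_sub, ← map_smul, h1, hg, sub_self]

lemma Module.Injective.exists_extension {M : Type u} [AddCommGroup M] [Module R M]
    (hM : Module.Injective R M) (A : Ideal R) (g : A →ₗ[R] M) :
    ∃ g' : R →ₗ[R] M, ∀ (x : R) (hx : x ∈ A), g' x = g ⟨x, hx⟩ := by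
  obtain ⟨g', hg'⟩ := hM.out A.subtype A.injective_subtype g
  exact ⟨g', fun x hx => hg' ⟨x, hx⟩⟩

/-- `Hom_R(P, -)` sends torsion-free injective modules to injective modules. -/
lemma HomFrom.injective [Module.Projective R P] [Module.Finite R P] {A : Ideal R}
    (hA : moduleTrace R P R = A) {I : Type u} [AddCommGroup I] [Module R I]
    (hI : Module.Injective R I) (hI' : IsTorsionFreeFor A I) :
    Module.Injective (Module.End R P)ᵐᵒᵖ (HomFrom R P I) := by
  let w : I ≃ₗ[R] DualHom R P (HomFrom R P I) := LinearEquiv.ofBijective (DualHom.unit P)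
    (DualHom.unit_bijective hA hI' (hI.exists_extension A))
  refine ⟨fun X Y _ _ _ _ i hi h => ?_⟩
  obtain ⟨H, hH⟩ := hI.out (DualHom.map (R := R) (P := P) i) (DualHom.map_injective hi)
    (w.symm.toLinearMap ∘ₗ DualHom.map h)
  -- To return from R-modules to Γ-modules, use the natural map Z → Hom_R(P, Hom_Γ(Hom_R(P, R), Z))
  -- given by the action of the endomorphisms q ↦ f(q)p. The extension `H` was found after applying
  -- Hom_Γ(Hom_R(P, R), -), where the target becomes I.
  let ev : ∀ {Z : Type u} [AddCommGroup Z] [Module (Module.End R P)ᵐᵒᵖ Z],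
      Z →ₗ[(Module.End R P)ᵐᵒᵖ] HomFrom R P (DualHom R P Z) := fun {Z} _ _ =>
    { toFun := fun z =>
        { toFun := fun p =>
            { toFun := fun f => (MulOpposite.op (f.smulRight p : P →ₗ[R] P) :
                (Module.End R P)ᵐᵒᵖ) • z
              map_add' := fun f g => by
                rw [← add_smul]
                congr 1
                exact congrArg MulOpposite.op (LinearMap.ext fun q => add_smul (f q) (g q) p)
              map_smul' := fun e f =>
                mul_smul e (MulOpposite.op (f.smulRight p : P →ₗ[R] P)) z }
          map_add' := fun p q => DualHom.ext fun f => by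
            refine Eq.trans ?_ (add_smul (MulOpposite.op (f.smulRight p : P →ₗ[R] P) :
                (Module.End R P)ᵐᵒᵖ) (MulOpposite.op (f.smulRight q : P →ₗ[R] P)) z)
            exact congrArg (fun e : P →ₗ[R] P => (MulOpposite.op e : (Module.End R P)ᵐᵒᵖ) • z)
              (LinearMap.ext fun x => smul_add (f x) p q)
          map_smul' := fun r p => DualHom.ext fun f =>
            congrArg (fun e : P →ₗ[R] P => (MulOpposite.op e : (Module.End R P)ᵐᵒᵖ) • z)
              (LinearMap.ext fun x => (mul_smul (f x) r p).symm) }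
      map_add' := fun z z' => HomFrom.ext fun p => DualHom.ext fun f => smul_add _ z z'
      map_smul' := fun e z => HomFrom.ext fun p => DualHom.ext fun f => by
        refine (mul_smul _ e z).symm.trans ?_
        exact congrArg (fun e : P →ₗ[R] P => (MulOpposite.op e : (Module.End R P)ᵐᵒᵖ) • z)
          (LinearMap.ext fun x => map_smul e.unop (f x) p) }
  have hev : ∀ {Z : Type u} [AddCommGroup Z] [Module (Module.End R P)ᵐᵒᵖ Z] (z : Z) (p : P)
      (f : HomFrom R P R), ev z p f =
        (MulOpposite.op (f.smulRight p : P →ₗ[R] P) : (Module.End R P)ᵐᵒᵖ) • z :=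
    fun _ _ _ => rfl
  refine ⟨HomFrom.map P H ∘ₗ ev, fun x => HomFrom.ext fun p => ?_⟩
  have h1 : ev (i x) p = DualHom.map i (ev x p) := DualHom.ext fun f => by
    rw [hev, DualHom.map_apply, hev, map_smul]
  change H (ev (i x) p) = h x p
  rw [h1, hH]
  change w.symm (DualHom.map h (ev x p)) = h x p
  rw [LinearEquiv.symm_apply_eq]
  refine DualHom.ext fun f => HomFrom.ext fun q => ?_
  rw [DualHom.map_apply, hev, map_smul]
  exact map_smul (h x) (f q) p

/-- `Hom_Γ(Hom_R(P, R), -)` preserves injective modules. -/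
lemma DualHom.injective [Module.Projective R P] [Module.Finite R P] {J : Type u} [AddCommGroup J]
    [Module (Module.End R P)ᵐᵒᵖ J] (hJ : Module.Injective (Module.End R P)ᵐᵒᵖ J) :
    Module.Injective R (DualHom R P J) := by
  obtain ⟨n, f, b, hfb⟩ := exists_dual_basis R P
  refine ⟨fun X Y _ _ _ _ i hi h => ?_⟩
  have hsum : ∀ (x : X) (g : HomFrom R P R), ∑ j, h (g (b j) • x) (f j) = h x g := fun x g => by
    conv_rhs => rw [← HomFrom.sum_mulRight hfb g, map_sum]
    exact Finset.sum_congr rfl fun j _ => by rw [map_smul, DualHom.smul_apply]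
  -- This is the adjoint of h, written with the dual basis; `hsum` recovers h from it. Extending it
  -- over Hom_R(P, Y) and composing with the unit solves the original problem.
  let t : HomFrom R P X →ₗ[(Module.End R P)ᵐᵒᵖ] J :=
    { toFun := fun g => ∑ j, h (g (b j)) (f j)
      map_add' := fun g g' => by
        rw [← Finset.sum_add_distrib]
        refine Finset.sum_congr rfl fun j _ => ?_
        rw [HomFrom.add_apply, map_add]
        rfl
      map_smul' := fun e g => by
        have h1 : ∀ j, h ((e • g) (b j)) (f j) =
            ∑ l, h ((e • f l) (b j) • g (b l)) (f j) := fun j => by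
          rw [HomFrom.smul_apply]
          conv_lhs => rw [← hfb (e.unop (b j)), map_sum, map_sum, DualHom.sum_apply]
          exact Finset.sum_congr rfl fun l _ => by rw [map_smul, HomFrom.smul_apply]
        rw [Finset.sum_congr rfl fun j _ => h1 j, Finset.sum_comm, RingHom.id_apply,
          Finset.smul_sum]
        exact Finset.sum_congr rfl fun l _ => by rw [hsum, map_smul] }
  obtain ⟨k, hk⟩ := hJ.out (HomFrom.map P i) (HomFrom.map_injective hi) t
  refine ⟨DualHom.map k ∘ₗ DualHom.unit P, fun x => DualHom.ext fun g => ?_⟩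
  have h1 : g.smulRight (i x) = HomFrom.map P i (g.smulRight x) :=
    HomFrom.ext fun p => (map_smul i (g p) x).symm
  change k (g.smulRight (i x)) = h x g
  rw [h1, hk]
  exact hsum x g

end HomFunctors

/-! ### Finite generation of the Hom modules -/

section Finiteness

lemma Module.Finite.of_forall_exists_smul_eq {k S V : Type*} [Semiring k] [Semiring S]
    [AddCommMonoid V] [Module k V] [Module S V] [Module.Finite k V]
    (h : ∀ a : k, ∃ s : S, ∀ v : V, a • v = s • v) : Module.Finite S V := by
  obtain ⟨t, ht⟩ := Module.Finite.fg_top (R := k) (M := V)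
  refine ⟨⟨t, eq_top_iff.mpr fun v _ => ?_⟩⟩
  have hv : v ∈ Submodule.span k (t : Set V) := ht ▸ Submodule.mem_top
  induction hv using Submodule.span_induction with
  | mem x hx => exact Submodule.subset_span hx
  | zero => exact zero_mem _
  | add x y _ _ hx hy => exact add_mem (hx trivial) (hy trivial)
  | smul a x _ hx =>
    obtain ⟨s, hs⟩ := h a
    rw [hs]
    exact Submodule.smul_mem _ s (hx trivial)

variable (k : Type v) {R : Type u} [CommRing k] [Ring R] [Algebra k R]

lemma isScalarTower_compHom (M : Type*) [AddCommGroup M] [Module R M] :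
    letI : Module k M := Module.compHom M (algebraMap k R)
    IsScalarTower k R M :=
  letI : Module k M := Module.compHom M (algebraMap k R)
  ⟨fun a r x => by rw [Algebra.smul_def, mul_smul]; rfl⟩

/-- The action of a central scalar as a linear map. -/
def scalarEnd (P : Type*) [AddCommGroup P] [Module R P] : k →+* (Module.End R P)ᵐᵒᵖ where
  toFun a := MulOpposite.op
    { toFun := fun x => algebraMap k R a • x
      map_add' := smul_add _
      map_smul' := fun r x => by
        rw [smul_smul, Algebra.commutes, mul_smul]; rfl }
  map_one' := congrArg MulOpposite.op (LinearMap.ext fun x => by simp)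
  map_mul' a b := congrArg MulOpposite.op (LinearMap.ext fun x => by
    change algebraMap k R (a * b) • x = algebraMap k R b • algebraMap k R a • x
    rw [mul_comm, map_mul, mul_smul])
  map_zero' := congrArg MulOpposite.op (LinearMap.ext fun x => by simp)
  map_add' a b := congrArg MulOpposite.op (LinearMap.ext fun x => by
    change algebraMap k R (a + b) • x = algebraMap k R a • x + algebraMap k R b • x
    rw [map_add, add_smul])

lemma scalarEnd_apply (P : Type*) [AddCommGroup P] [Module R P] (a : k) (p : P) :
    (scalarEnd k (R := R) P a).unop p = algebraMap k R a • p := rfl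

/-- The opposite endomorphism ring of a module is an algebra. -/
@[reducible]
def endOpAlgebra (P : Type*) [AddCommGroup P] [Module R P] :
    Algebra k (Module.End R P)ᵐᵒᵖ :=
  (scalarEnd k (R := R) P).toAlgebra' fun a e => by
    refine congrArg MulOpposite.op (LinearMap.ext fun x => ?_)
    exact map_smul e.unop (algebraMap k R a) x

lemma HomFrom.exists_finite_module [IsArtinianRing k] [Module.Finite k R] (P M : Type u)
    [AddCommGroup P] [Module R P] [Module.Finite R P] [AddCommGroup M] [Module R M]
    [Module.Finite R M] : ∃ _ : Module k (HomFrom R P M), Module.Finite k (HomFrom R P M) ∧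
      ∀ (a : k) (f : HomFrom R P M) (p : P), (a • f) p = algebraMap k R a • f p := by
  let _ : Module k M := Module.compHom M (algebraMap k R)
  have := isScalarTower_compHom k (R := R) M
  have : SMulCommClass R k M := IsScalarTower.to_smulCommClass'
  have : Module.Finite k M := Module.Finite.trans R M
  have := isNoetherian_linearMap_of_finite k (R := R) P M
  have : Module.Finite k (P →ₗ[R] M) := inferInstance
  exact ⟨inferInstanceAs (Module k (P →ₗ[R] M)), this, fun _ _ _ => rfl⟩

lemma HomFrom.finite [IsArtinianRing k] [Module.Finite k R] (P M : Type u) [AddCommGroup P]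
    [Module R P] [Module.Finite R P] [AddCommGroup M] [Module R M] [Module.Finite R M] :
    Module.Finite (Module.End R P)ᵐᵒᵖ (HomFrom R P M) := by
  obtain ⟨_, _, h⟩ := HomFrom.exists_finite_module k (R := R) P M
  refine Module.Finite.of_forall_exists_smul_eq fun a : k => ⟨scalarEnd k (R := R) P a, fun f => ?_⟩
  exact HomFrom.ext fun p => (h a f p).trans (map_smul f (algebraMap k R a) p).symm

/-- This makes Γ an artin algebra, so the results on injective hulls and decompositions apply to it
too. -/
lemma finite_endOpAlgebra [IsArtinianRing k] [Module.Finite k R] (P : Type u) [AddCommGroup P]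
    [Module R P] [Module.Finite R P] :
    letI := endOpAlgebra k (R := R) P
    Module.Finite k (Module.End R P)ᵐᵒᵖ := by
  let _ := endOpAlgebra k (R := R) P
  obtain ⟨_, _, h⟩ := HomFrom.exists_finite_module k (R := R) P P
  let f : HomFrom R P P →ₗ[k] (Module.End R P)ᵐᵒᵖ :=
    { toFun := fun e => MulOpposite.op (e : P →ₗ[R] P)
      map_add' := fun _ _ => rfl
      map_smul' := fun a e => congrArg MulOpposite.op (LinearMap.ext fun x =>
        (h a e x).trans (map_smul e (algebraMap k R a) x).symm) }
  exact Module.Finite.of_surjective f fun e => ⟨(e.unop : P →ₗ[R] P), rfl⟩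

lemma DualHom.finite [IsArtinianRing k] [Module.Finite k R] (P N : Type u) [AddCommGroup P]
    [Module R P] [Module.Finite R P] [AddCommGroup N] [Module (Module.End R P)ᵐᵒᵖ N]
    [Module.Finite (Module.End R P)ᵐᵒᵖ N] : Module.Finite R (DualHom R P N) := by
  let _ := endOpAlgebra k (R := R) P
  have := finite_endOpAlgebra k (R := R) P
  let _ : Module k N := Module.compHom N (algebraMap k (Module.End R P)ᵐᵒᵖ)
  have := isScalarTower_compHom k (R := (Module.End R P)ᵐᵒᵖ) N
  have : SMulCommClass (Module.End R P)ᵐᵒᵖ k N := IsScalarTower.to_smulCommClass'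
  have : Module.Finite k N := Module.Finite.trans (Module.End R P)ᵐᵒᵖ N
  have := HomFrom.finite k (R := R) P R
  have := isNoetherian_linearMap_of_finite k (R := (Module.End R P)ᵐᵒᵖ) (HomFrom R P R) N
  have : Module.Finite k (HomFrom R P R →ₗ[(Module.End R P)ᵐᵒᵖ] N) := inferInstance
  let _ : Module k (DualHom R P N) :=
    inferInstanceAs (Module k (HomFrom R P R →ₗ[(Module.End R P)ᵐᵒᵖ] N))
  have : Module.Finite k (DualHom R P N) := this
  refine Module.Finite.of_forall_exists_smul_eq fun a : k => ⟨algebraMap k R a, fun φ => ?_⟩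
  refine DualHom.ext fun f => ?_
  have h : f.mulRight (algebraMap k R a) = scalarEnd k (R := R) P a • f := HomFrom.ext fun p => by
    rw [HomFrom.mulRight_apply, HomFrom.smul_apply, scalarEnd_apply, map_smul, smul_eq_mul,
      Algebra.commutes]
  rw [DualHom.smul_apply, h, map_smul]
  rfl

end Finiteness

/-! ### Modules Ext-orthogonal to the quotient ring -/

section ExtVanishing

variable {R : Type u} [Ring R]

lemma subsingleton_ext_of_retract {C : Type*} [Category C] [Abelian C] [HasExt.{u} C]
    {X X' Y Y' : C} (r : Retract X X') (t : Retract Y Y') (n : ℕ)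
    (h : Subsingleton (Abelian.Ext.{u} X' Y' n)) : Subsingleton (Abelian.Ext.{u} X Y n) := by
  have key : ∀ x : Abelian.Ext.{u} X Y n, x = 0 := fun x => by
    have h1 : ((Abelian.Ext.mk₀ r.r).comp x (zero_add n)).comp (Abelian.Ext.mk₀ t.i)
      (add_zero n) = 0 := h.elim _ _
    have h2 : ((Abelian.Ext.mk₀ r.r).comp x (zero_add n)) = 0 := by
      rw [← Abelian.Ext.comp_mk₀_id ((Abelian.Ext.mk₀ r.r).comp x (zero_add n)), ← t.retract,
        ← Abelian.Ext.mk₀_comp_mk₀, ← Abelian.Ext.comp_assoc_of_second_deg_zero, h1,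
        Abelian.Ext.zero_comp]
    rw [← Abelian.Ext.mk₀_id_comp x, ← r.retract, ← Abelian.Ext.mk₀_comp_mk₀,
      Abelian.Ext.comp_assoc_of_second_deg_zero, h2, Abelian.Ext.comp_zero]
  exact ⟨fun x y => by rw [key x, key y]⟩

variable (A : Ideal R)

/-- The finitely generated modules `M` with `Ext^i_R(R ⧸ A, M) = 0` for all `i ≥ 0`. -/
def IsExtOrthogonal (M : FGModuleCat.{u} R) : Prop :=
  IsTorsionFreeFor A M ∧
    ∀ i : ℕ, 1 ≤ i → Subsingleton (Abelian.Ext.{u} (ModuleCat.of R (R ⧸ A)) M.obj i)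

lemma isAddClosed_isExtOrthogonal : IsAddClosed (IsExtOrthogonal A) where
  of_subsingleton M hM := by
    refine ⟨fun m _ => Subsingleton.elim _ _, fun i _ => ?_⟩
    have h0 : Limits.IsZero M.obj := @ModuleCat.isZero_of_subsingleton _ _ M.obj hM
    have := h0.hasInjectiveDimensionLT_zero
    exact HasInjectiveDimensionLT.subsingleton M.obj 0 i (Nat.zero_le i) _
  prod {M N K} e hM hN := by
    refine ⟨fun m hm => ?_, fun i hi => ?_⟩
    · have h1 : ∀ a ∈ A, a • e m = 0 := fun a ha => by rw [← map_smul, hm a ha, map_zero]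
      exact e.map_eq_zero_iff.mp (Prod.ext (hM.1 _ fun a ha => congrArg Prod.fst (h1 a ha))
        (hN.1 _ fun a ha => congrArg Prod.snd (h1 a ha)))
    · have hex : Function.Exact (e.symm.toLinearMap ∘ₗ LinearMap.inl R M N)
          (LinearMap.snd R M N ∘ₗ e.toLinearMap) := fun x => by
        constructor
        · intro h
          refine ⟨(e x).1, ?_⟩
          change e.symm ((e x).1, (0 : N)) = x
          rw [LinearEquiv.symm_apply_eq]
          exact Prod.ext rfl (Eq.symm h)
        · rintro ⟨y, rfl⟩
          change (e (e.symm (y, 0))).2 = 0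
          rw [e.apply_symm_apply]
      have hS := hex.shortExact (e.symm.injective.comp LinearMap.inl_injective)
        (Prod.snd_surjective.comp e.surjective)
      have key : ∀ x : Abelian.Ext.{u} (ModuleCat.of R (R ⧸ A)) K.obj i, x = 0 := fun x => by
        obtain ⟨y, rfl⟩ := Abelian.Ext.covariant_sequence_exact₂ _ hS x ((hN.2 i hi).elim _ _)
        rw [show y = 0 from (hM.2 i hi).elim _ _, Abelian.Ext.zero_comp]
      exact ⟨fun x y => by rw [key x, key y]⟩
  summand {M N K} e hK := by
    refine ⟨fun m hm => ?_, fun i hi => ?_⟩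
    · have := hK.1 (e.symm (m, (0 : N))) fun a ha => by
        rw [← map_smul, Prod.smul_mk, hm a ha, smul_zero]
        exact map_zero e.symm
      exact congrArg Prod.fst (e.symm.map_eq_zero_iff.mp this)
    · refine subsingleton_ext_of_retract (Retract.refl _) (Y' := K.obj)
        { i := ModuleCat.ofHom (e.symm.toLinearMap ∘ₗ LinearMap.inl R M N)
          r := ModuleCat.ofHom (LinearMap.fst R M N ∘ₗ e.toLinearMap)
          retract := ?_ } i (hK.2 i hi)
      ext x
      change (e (e.symm (x, 0))).1 = x
      rw [e.apply_symm_apply]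

/-- The cosyzygy of an Ext-orthogonal module, formed with an injective hull. -/
lemma IsExtOrthogonal.exists_cosyzygy (k : Type v) [CommRing k] [Algebra k R] [IsArtinianRing k]
    [Module.Finite k R] [A.IsTwoSided] {M : FGModuleCat.{u} R} (hM : IsExtOrthogonal A M) :
    ∃ (I C : FGModuleCat.{u} R) (f : M →ₗ[R] I) (g : I →ₗ[R] C), Module.Injective R I ∧
      IsTorsionFreeFor A I ∧ IsExtOrthogonal A C ∧ Function.Injective f ∧ Function.Exact f g ∧
      Function.Surjective g := by
  obtain ⟨I, f, hf, hI, hess⟩ := exists_fg_injectiveHull k M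
  -- If A kills x, then Rx meets M in elements killed by A, hence trivially, and essentiality gives
  -- x = 0.
  have hI' : IsTorsionFreeFor A I := by
    intro x hx
    by_contra hx0
    have h1 : Submodule.span R {x} ≠ ⊥ := by simpa using hx0
    refine h1 (hess _ ?_)
    rw [eq_bot_iff]
    rintro _ ⟨hy, m, rfl⟩
    obtain ⟨r, hr⟩ := Submodule.mem_span_singleton.mp hy
    have h2 : m = 0 := hM.1 m fun a ha => hf (by
      rw [map_smul, ← hr, smul_smul, hx _ (A.mul_mem_right r ha), map_zero])
    simp [h2]
  refine ⟨I, FGModuleCat.of R (I ⧸ LinearMap.range f), f, Submodule.mkQ _, hI, hI',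
    ⟨fun c hc => ?_, fun i hi => ?_⟩, hf, LinearMap.exact_map_mkQ_range f,
    Submodule.mkQ_surjective _⟩
  · obtain ⟨z, rfl⟩ := Submodule.mkQ_surjective _ c
    -- The map a ↦ az from A to M extends to R because Ext¹(R ⧸ A, M) = 0; then z minus the image of
    -- the value at 1 is killed by A in the torsion-free I.
    have hz : ∀ a ∈ A, a • z ∈ LinearMap.range f := fun a ha =>
      (Submodule.Quotient.mk_eq_zero _).mp (hc a ha)
    let g : A →ₗ[R] M := (LinearEquiv.ofInjective f hf).symm.toLinearMap ∘ₗ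
      LinearMap.codRestrict (LinearMap.range f) (LinearMap.toSpanSingleton R I z ∘ₗ A.subtype)
        fun a => hz a a.2
    have hg : ∀ a : A, f (g a) = (a : R) • z := fun a => congrArg Subtype.val
      ((LinearEquiv.ofInjective f hf).apply_symm_apply ⟨(a : R) • z, hz a a.2⟩)
    obtain ⟨g', hg'⟩ := exists_extension_of_subsingleton_ext A (hM.2 1 le_rfl) g
    have h1 : z - f (g' 1) = 0 := hI' _ fun a ha => by
      rw [smul_sub, ← map_smul, ← map_smul, smul_eq_mul, mul_one, hg' a ha, hg, sub_self]
    exact (Submodule.Quotient.mk_eq_zero _).mpr ⟨g' 1, (sub_eq_zero.mp h1).symm⟩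
  · have hS := (LinearMap.exact_map_mkQ_range f).shortExact hf (Submodule.mkQ_surjective _)
    have hI'' : Injective (ModuleCat.of R I) := (Module.injective_iff_injective_object R I).mp hI
    have key : ∀ x : Abelian.Ext.{u} (ModuleCat.of R (R ⧸ A))
        (ModuleCat.of R (I ⧸ LinearMap.range f)) i, x = 0 := fun x => by
      obtain ⟨y, rfl⟩ := Abelian.Ext.covariant_sequence_exact₃ _ hS x rfl
        ((hM.2 (i + 1) (by lia)).elim _ _)
      obtain ⟨j, rfl⟩ : ∃ j, i = j + 1 := ⟨i - 1, by lia⟩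
      have : y = 0 := Abelian.Ext.eq_zero_of_injective _
      rw [this, Abelian.Ext.zero_comp]
    exact ⟨fun x y => (key x).trans (key y).symm⟩

section Torsion

variable {A} [A.IsTwoSided]

/-- Over a strong idempotent ideal, modules annihilated by `A` have no higher extensions by
`R ⧸ A`. -/
lemma IsStrongIdempotent.subsingleton_ext (hA : IsStrongIdempotent A) (X : Type u)
    [AddCommGroup X] [Module R X] [Module.Finite R X] (hX : ∀ a ∈ A, ∀ x : X, a • x = 0) (i : ℕ)
    (hi : 1 ≤ i) :
    Subsingleton (Abelian.Ext.{u} (ModuleCat.of R (R ⧸ A)) (ModuleCat.of R X) i) := by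
  have hX' : Module.IsTorsionBySet R X (A : Set R) := fun x a => hX a a.2 x
  let _ : Module (R ⧸ A) X := hX'.module
  have : Module.Finite (R ⧸ A) X := by
    obtain ⟨t, ht⟩ := Module.Finite.fg_top (R := R) (M := X)
    refine ⟨⟨t, eq_top_iff.mpr fun v _ => ?_⟩⟩
    have hv : v ∈ Submodule.span R (t : Set X) := ht ▸ Submodule.mem_top
    induction hv using Submodule.span_induction with
    | mem x hx => exact Submodule.subset_span hx
    | zero => exact zero_mem _
    | add x y _ _ hx hy => exact add_mem (hx trivial) (hy trivial)
    | smul a x _ hx => exact Submodule.smul_mem _ (Ideal.Quotient.mk A a) (hx trivial)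
  -- Surjectivity of the comparison map is enough: its source vanishes in positive degrees because R
  -- ⧸ A is projective over itself.
  have hs := (hA.2 (FGModuleCat.of (R ⧸ A) (R ⧸ A)) (FGModuleCat.of (R ⧸ A) X) i).2
  have hP : Projective (ModuleCat.of (R ⧸ A) (R ⧸ A)) :=
    (IsProjective.iff_projective _).mp inferInstance
  have hz : Subsingleton (Abelian.Ext.{u} (ModuleCat.of (R ⧸ A) (R ⧸ A))
      (ModuleCat.of (R ⧸ A) X) i) := by
    have := projective_iff_hasProjectiveDimensionLT_one.mp hP
    exact HasProjectiveDimensionLT.subsingleton _ 1 i hi _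
  have h1 := @Function.Surjective.subsingleton _ _ _ hz hs
  let e₁ : ModuleCat.of R (R ⧸ A) ≅ (ModuleCat.restrictScalars.{u} (Ideal.Quotient.mk A)).obj
      (ModuleCat.of (R ⧸ A) (R ⧸ A)) :=
    LinearEquiv.toModuleIso
      { AddEquiv.refl (R ⧸ A) with
        map_smul' := fun r x => by
          obtain ⟨x, rfl⟩ := Ideal.Quotient.mk_surjective x
          rfl }
  let e₂ : ModuleCat.of R X ≅ (ModuleCat.restrictScalars.{u} (Ideal.Quotient.mk A)).obj
      (ModuleCat.of (R ⧸ A) X) :=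
    LinearEquiv.toModuleIso
      { AddEquiv.refl X with
        map_smul' := fun r x => rfl }
  exact subsingleton_ext_of_retract e₁.retract e₂.retract i h1

/-- The torsion-free quotient of a module in the class `𝕋` is Ext-orthogonal to `R ⧸ A`. -/
lemma isExtOrthogonal_quotient_moduleTrace [IsNoetherianRing R] [IsArtinianRing R]
    (hA : IsStrongIdempotent A) {T : FGModuleCat.{u} R} (hT : T ∈ classT A) :
    IsExtOrthogonal A (FGModuleCat.of R (T ⧸ moduleTrace R (R ⧸ A) T)) := by
  refine ⟨fun y hy => ?_, fun i hi => ?_⟩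
  · obtain ⟨t, rfl⟩ := Submodule.mkQ_surjective _ y
    refine (Submodule.Quotient.mk_eq_zero _).mpr ((mem_moduleTrace_quotient_iff A).mpr ?_)
    -- If A kills the class of t then At ⊆ τT, so A²t = 0, and A² = A.
    have h1 : ∀ a ∈ A, ∀ b ∈ A, (b * a) • t = 0 := fun a ha b hb => by
      have := (Submodule.Quotient.mk_eq_zero _).mp (hy a ha)
      rw [mul_smul]
      exact (mem_moduleTrace_quotient_iff A).mp this b hb
    intro a ha
    have ha' : a ∈ A * A := hA.1.symm ▸ ha
    induction ha' using Submodule.mul_induction_on' with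
    | mem_mul_mem b hb c hc => exact h1 c hc b hb
    | add x hx y hy hx' hy' =>
      rw [add_smul, hx' (Ideal.mul_le_right hx), hy' (Ideal.mul_le_right hy), add_zero]
  · have hS := (LinearMap.exact_subtype_mkQ (moduleTrace R (R ⧸ A) T)).shortExact
      (Submodule.injective_subtype _) (Submodule.mkQ_surjective _)
    have hX := hA.subsingleton_ext (moduleTrace R (R ⧸ A) T)
      (fun a ha x => Subtype.ext ((mem_moduleTrace_quotient_iff A).mp x.2 a ha)) (i + 1) (by lia)
    have key : ∀ x : Abelian.Ext.{u} (ModuleCat.of R (R ⧸ A))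
        (ModuleCat.of R (T ⧸ moduleTrace R (R ⧸ A) T)) i, x = 0 := fun x => by
      obtain ⟨y, rfl⟩ := Abelian.Ext.covariant_sequence_exact₃ _ hS x rfl (hX.elim _ _)
      rw [show y = 0 from (hT i hi).elim _ _, Abelian.Ext.zero_comp]
    exact ⟨fun x y => (key x).trans (key y).symm⟩

end Torsion

end ExtVanishing

/-! ### Comparison of φ_r over `R` and over the endomorphism ring -/

section Comparison

variable {R : Type u} [Ring R]

lemma isAddClosed_true : IsAddClosed (fun _ : FGModuleCat.{u} R => True) where
  of_subsingleton _ _ := trivial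
  prod _ _ _ := trivial
  summand _ _ := trivial

/-- A homomorphism `ρ` of the groups `KInj` that has a left inverse and commutes with the cosyzygy
on the classes of the modules in `Q`, a class of modules closed under suitable cosyzygies, compares
the functions `φ_r`. -/
lemma phiR_le_of_hom {S : Type u} [Ring S] {Q : FGModuleCat.{u} R → Prop}
    (hQ : ∀ {A B C : FGModuleCat.{u} R}, (C ≃ₗ[R] A × B) → Q C → Q A)
    (F : FGModuleCat.{u} R → FGModuleCat.{u} S) (ρ : KInj R →+ KInj S) (γ : KInj S →+ KInj R)
    (hρ : ∀ M, Q M → ρ (kClass M) = kClass (F M)) (hγ : ∀ M, Q M → γ (kClass (F M)) = kClass M)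
    (hΩ : ∀ M, Q M → ∃ C, Q C ∧ cosyzygyHom R (kClass M) = kClass C ∧
      cosyzygyHom S (kClass (F M)) = kClass (F C))
    {Y : FGModuleCat.{u} R} (hY : Q Y)
    (hF : ∀ X W : FGModuleCat.{u} R, (Y ≃ₗ[R] X × W) → kClass (F X) ∈ cosyzygyAdd (F Y) 0) :
    phiR Y ≤ phiR (F Y) := by
  -- Compatibility of `ρ` with cosyzygies and the identity γρ = id are only available on the
  -- subgroup generated by classes from `Q`, which contains all Ω⁻ˢ⟨add Y⟩.
  let L : AddSubgroup (KInj R) := AddSubgroup.closure {x | ∃ M, Q M ∧ x = kClass M}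
  have hL : ∀ x ∈ L, cosyzygyHom R x ∈ L ∧ ρ (cosyzygyHom R x) = cosyzygyHom S (ρ x) ∧
      γ (ρ x) = x := by
    intro x hx
    induction hx using AddSubgroup.closure_induction with
    | mem x hx =>
      obtain ⟨M, hM, rfl⟩ := hx
      obtain ⟨C, hC, h1, h2⟩ := hΩ M hM
      refine ⟨h1 ▸ AddSubgroup.subset_closure ⟨C, hC, rfl⟩, ?_, ?_⟩
      · rw [h1, hρ C hC, hρ M hM, h2]
      · rw [hρ M hM, hγ M hM]
    | zero => simp
    | add x y _ _ hx hy =>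
      refine ⟨?_, ?_, ?_⟩
      · rw [map_add]; exact add_mem hx.1 hy.1
      · simp only [map_add, hx.2.1, hy.2.1]
      · rw [map_add, map_add, hx.2.2, hy.2.2]
    | neg x _ hx =>
      refine ⟨?_, ?_, ?_⟩
      · rw [map_neg]; exact neg_mem hx.1
      · simp only [map_neg, hx.2.1]
      · rw [map_neg, map_neg, hx.2.2]
  have hle : ∀ s, cosyzygyAdd Y s ≤ L ∧ ∀ x ∈ cosyzygyAdd Y s, ρ x ∈ cosyzygyAdd (F Y) s := by
    intro s
    induction s with
    | zero =>
      refine ⟨(AddSubgroup.closure_le _).mpr ?_, ?_⟩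
      · rintro _ ⟨X, W, -, ⟨e⟩, rfl⟩
        exact AddSubgroup.subset_closure ⟨X, hQ e hY, rfl⟩
      · have h1 : cosyzygyAdd Y 0 ≤ (cosyzygyAdd (F Y) 0).comap ρ := by
          refine (AddSubgroup.closure_le _).mpr ?_
          rintro _ ⟨X, W, -, ⟨e⟩, rfl⟩
          have := hF X W e
          rwa [← hρ X (hQ e hY)] at this
        exact h1
    | succ s ih =>
      refine ⟨?_, ?_⟩
      · rintro _ ⟨x, hx, rfl⟩
        exact (hL x (ih.1 hx)).1
      · rintro _ ⟨x, hx, rfl⟩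
        exact ⟨ρ x, ih.2 x hx, (hL x (ih.1 hx)).2.1.symm⟩
  rcases eq_or_ne (phiR (F Y)) ⊤ with h | h
  · rw [h]; exact le_top
  · obtain ⟨n, hn⟩ := ENat.ne_top_iff_exists.mp h
    rw [← hn, phiR_le_iff]
    intro s hs x hx h0
    have hxL := hL x ((hle s).1 hx)
    have h1 : ρ x = 0 := phiR_le_iff.mp hn.ge s hs (ρ x) ((hle s).2 x hx) (by
      rw [← hxL.2.1, h0, map_zero])
    rw [← hxL.2.2, h1, map_zero]

/-- For a module `Y` that is Ext-orthogonal to `R ⧸ A`, passing to `Hom_R(P, Y)` does not decrease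
`φ_r`. -/
lemma IsExtOrthogonal.phiR_le (k : Type v) [CommRing k] [Algebra k R] [IsArtinianRing k]
    [Module.Finite k R] {A : Ideal R} [A.IsTwoSided] (P : FGModuleCat.{u} R)
    [Module.Projective R P] (hP : moduleTrace R P R = A) {Y : FGModuleCat.{u} R}
    (hY : IsExtOrthogonal A Y) : phiR Y ≤ phiRDim (Set.univ :
      Set (FGModuleCat.{u} (Module.End R P)ᵐᵒᵖ)) := by
  have := isNoetherianRing_of_artinAlgebra k (R := R)
  have := isArtinianRing_of_artinAlgebra k (R := R)
  have hΓ := finite_endOpAlgebra k (R := R) P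
  let _ := endOpAlgebra k (R := R) P
  have := isNoetherianRing_of_artinAlgebra k (R := (Module.End R P)ᵐᵒᵖ)
  have := isArtinianRing_of_artinAlgebra k (R := (Module.End R P)ᵐᵒᵖ)
  have hfin := fun M : FGModuleCat.{u} R => HomFrom.finite k (R := R) P M
  have hfin' := fun N : FGModuleCat.{u} (Module.End R P)ᵐᵒᵖ => DualHom.finite k (R := R) P N
  let F : FGModuleCat.{u} R → FGModuleCat.{u} (Module.End R P)ᵐᵒᵖ := fun M =>
    @FGModuleCat.of (Module.End R P)ᵐᵒᵖ _ (HomFrom R P M) _ _ (hfin M)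
  let G : FGModuleCat.{u} (Module.End R P)ᵐᵒᵖ → FGModuleCat.{u} R := fun N =>
    @FGModuleCat.of R _ (DualHom R P N) _ _ (hfin' N)
  -- Injectivity is preserved by Hom_R(P, -) here because Ext-orthogonal modules are torsion-free;
  -- the functor in the other direction preserves all injectives and needs no restriction.
  obtain ⟨ρ, hρ⟩ := (isAddClosed_isExtOrthogonal A).exists_hom F
    (fun e => ⟨HomFrom.prodEquiv e⟩) (fun I hI hI' => HomFrom.injective hP hI' hI.1)
  obtain ⟨γ, hγ⟩ := (isAddClosed_true (R := (Module.End R P)ᵐᵒᵖ)).exists_hom G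
    (fun e => ⟨DualHom.prodEquiv e⟩) (fun J _ hJ => DualHom.injective hJ)
  have hγ' : ∀ M, IsExtOrthogonal A M → γ (kClass (F M)) = kClass M := fun M hM => by
    rw [hγ _ trivial]
    exact (kClass_congr (LinearEquiv.ofBijective (DualHom.unit P) (DualHom.unit_bijective hP hM.1
      (exists_extension_of_subsingleton_ext A (hM.2 1 le_rfl))))).symm
  have hR := enoughInjectivesFG_of_artinAlgebra k (R := R)
  have hS := enoughInjectivesFG_of_artinAlgebra k (R := (Module.End R P)ᵐᵒᵖ)
  have hΩ : ∀ M, IsExtOrthogonal A M → ∃ C, IsExtOrthogonal A C ∧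
      cosyzygyHom R (kClass M) = kClass C ∧
      cosyzygyHom (Module.End R P)ᵐᵒᵖ (kClass (F M)) = kClass (F C) := fun M hM => by
    obtain ⟨I, C, f, g, hI, hI', hC, hf, hfg, hg⟩ := hM.exists_cosyzygy A k
    exact ⟨C, hC, cosyzygyHom_kClass hR ⟨I, f, g, hI, hf, hfg, hg⟩,
      cosyzygyHom_kClass hS ⟨F I, HomFrom.map P f, HomFrom.map P g, HomFrom.injective hP hI hI',
        HomFrom.map_injective hf, HomFrom.map_exact hf hfg, HomFrom.map_surjective hg⟩⟩
  refine (phiR_le_of_hom (isAddClosed_isExtOrthogonal A).summand F ρ γ hρ hγ' hΩ hY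
    fun X W e => ?_).trans (le_iSup₂ (f := fun M _ => phiR M) (F Y) (Set.mem_univ _))
  exact kClass_mem_cosyzygyAdd_zero (X := F X) (Y := F W) (HomFrom.prodEquiv e)

/-- For b = ⊥ take s = 0, which disappears in the maximum; for b = ⊤ there is nothing to prove; for
finite b take s = b and give away the summand 1. -/
lemma coe_le_max_of_forall_nat {b : WithBot ℕ∞} {x y : ℕ∞}
    (h : ∀ s : ℕ, b ≤ s → x ≤ max (s : ℕ∞) y) :
    (x : WithBot ℕ∞) ≤ max (b + 1) (y : WithBot ℕ∞) := by
  induction b with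
  | bot =>
    refine le_max_of_le_right (WithBot.coe_le_coe.mpr ?_)
    simpa using h 0 bot_le
  | coe b =>
    induction b with
    | top =>
      have : ((⊤ : ℕ∞) : WithBot ℕ∞) + 1 = ⊤ := rfl
      exact le_max_of_le_left (this ▸ le_top)
    | coe n =>
      have h1 := h n le_rfl
      have h2 : (x : WithBot ℕ∞) ≤ max ((n : ℕ∞) : WithBot ℕ∞) (y : WithBot ℕ∞) := by
        exact_mod_cast h1
      refine h2.trans (max_le_max_right _ ?_)
      exact_mod_cast (le_self_add : (n : ℕ∞) ≤ n + 1)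

end Comparison

theorem proposition4p15 {k : Type v} {Λ : Type u} [CommRing k] [IsArtinianRing k] [Ring Λ]
    [Algebra k Λ] [Module.Finite k Λ] (A : Ideal Λ) [A.IsTwoSided]
    (hA : IsStrongIdempotent A) (hgld : globalDim (Λ ⧸ A) ≠ ⊤) :
    (∀ T : FGModuleCat.{u} Λ,
      (phiR T : WithBot ℕ∞) ≤
        max (globalDim (Λ ⧸ A) + projectiveDimension (rightQuotient A) + 1)
          (phiR (FGModuleCat.of Λ (T ⧸ moduleTrace Λ (Λ ⧸ A) T)) : WithBot ℕ∞)) ∧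
    (∀ P : FGModuleCat.{u} Λ, Module.Projective Λ P → moduleTrace Λ P Λ = A →
      (phiRDim (classT A) : WithBot ℕ∞) ≤
        max (globalDim (Λ ⧸ A) + projectiveDimension (rightQuotient A) + 1)
          (phiRDim (Set.univ : Set (FGModuleCat.{u} (Module.End Λ P)ᵐᵒᵖ)) : WithBot ℕ∞)) := by
  have := isNoetherianRing_of_artinAlgebra k (R := Λ)
  have := isArtinianRing_of_artinAlgebra k (R := Λ)
  have key := fun (s : ℕ) hs T => phiR_le_max_phiR_quotient A
    (enoughInjectivesFG_of_artinAlgebra k (R := Λ)) s hs T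
  refine ⟨fun T => coe_le_max_of_forall_nat fun s hs => key s hs T, fun P hP hPA =>
    coe_le_max_of_forall_nat fun s hs => iSup₂_le fun T hT => ?_⟩
  exact (key s hs T).trans (max_le_max_left _
    ((isExtOrthogonal_quotient_moduleTrace hA hT).phiR_le k P hPA))
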